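/- **Slicing and no-collision distances.** Label sets by binary words $w=i_0i_1\cdots i_m$ with $i_0=0$. A slicing schedule $\mathcal S=((b_k,s_k))_{k\ge 1}$ in $\mathbb R^d$ consists of labels $b_k$ and unit vectors $s_k$ as follows. Given an absolutely continuous probability measure $\mu$, start with the one-set partition $\mathcal C_0^\mu=\{\Omega^\mu_0\}$, $\Omega_0^\mu=\mathbb R^d$. At step $k\ge1$, $b_k$ is the label of a set of $\mathcal C_{k-1}^\mu$; choose $h_k\in\mathbb R$ such that the half-spaces $\{x\cdot s_k\le h_k\}$ and $\{x\cdot s_k>h_k\}$ divide $\Omega^\mu_{b_k}$ into two parts of equal $\mu$-mass (the least such $h_k$, if there are several), call these parts $\Omega^\mu_{b_k0}$ and $\Omega^\mu_{b_k1}$ respectively, and replace $\Omega^\mu_{b_k}$ by them to get $\mathcal C^\mu_k$. Let $\ell^\mu_k(x)=\sum_{\alpha=0}^m i_\alpha 3^{-\alpha}$ for $x\in\Omega^\mu_{i_0\cdots i_m}\in\mathcal C_k^\mu$, and $\ell^\mu=\lim_{k\to\infty}\ell^\mu_k$. The no-collision map $t_\mu^\nu$ sends ($\mu$-almost every) $x$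 to the unique $y\in\operatorname{int}(\operatorname{supp}\nu)$ with $\ell^\nu(y)=\ell^\mu(x)$ (where such a unique $y$ does not exist, put $t_\mu^\nu(x)=0$), and $$W_{\mathcal S,2}(\mu,\nu)=\Big(\int_{\mathbb R^d}|t_\mu^\nu(x)-x|^2\,d\mu(x)\Big)^{1/2}.$$ Call $\mathcal S$ *admissible* if there is a basis $\{e_1,\dots,e_d\}$ of $\mathbb R^d$ such that every $s_k$ is one of the $e_i$, and every set appearing in the partition is divided in each direction $e_i$ infinitely many times, i.e. for every infinite binary sequence $i_0i_1i_2\cdots$ with $i_0=0$ and every $i$ there are infinitely many $k$ for which $b_k$ is an initial segment of the sequence and $s_k=e_i$. Call $\mathcal S$ *axis-parallel* if every $s_k$ is parallel to a coordinate axis. **Theorem.** Let $a,b>0$ and $u=(u_1,u_2)\in\mathbb R^2$, $u\neq0$. Let $\mu_0$ be the uniform probability measure on the elliptical domain $$\mathcal E=\Big\{(x_1,x_2)\in\mathbb R^2:\ \frac{(x_1-u_1)^2}{a^2}+\frac{(x_2-u_2)^2}{b^2}\le1\Big\},$$ and let $\mu_t=(R_t)_\sharp\mu_0$, where $R_t$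 is the counter-clockwise rotation of $\mathbb R^2$ about the origin by the angle $t$. Let $\mathcal S$ be an admissible axis-parallel slicing schedule in $\mathbb R^2$. Then $\big(\{\mu_t\}_{t\in[0,2\pi]},W_{\mathcal S,2}\big)$ is isometric to a planar circle $\{x\in\mathbb R^2:|x|=r\}$ for some $r>0$, with the Euclidean distance $|\cdot|$, if and only if $a=b$. -/

import Mathlib

open MeasureTheory Filter Topology
open scoped ENNReal

noncomputable section

/-- The labels of the sets of the partition after `k` slices, when the set labelled `b j` is the one
that is divided at step `j + 1`. Labels are binary words `i₀ i₁ ⋯ iₘ` with `i₀ = 0`; the whole space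
has the label `0`, and dividing the set labelled `w` replaces `w` by `w0` and `w1`. -/
def activeLabels (b : ℕ → List Bool) : ℕ → Finset (List Bool)
  | 0 => {[false]}
  | k + 1 => (activeLabels b k).erase (b k) ∪ {b k ++ [false], b k ++ [true]}

/-- A slicing schedule in `ℝ^d`: at step `k + 1` the set labelled `label k`, which has to be one of
the sets present after `k` steps, is divided in the direction of the unit vector `dir k`. -/
structure SlicingSchedule (d : ℕ) where
  label : ℕ → List Bool
  dir : ℕ → EuclideanSpace ℝ (Fin d)
  label_mem : ∀ k, label k ∈ activeLabels label k
  norm_dir : ∀ k, ‖dir k‖ = 1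

/-- A level `h` at which the hyperplane `x · s = h` divides `Ω` into two parts of equal `μ`-mass.
Where there are several such levels, they give the same parts up to null sets, and the least one
is taken. -/
def cutLevel {d : ℕ} (μ : Measure (EuclideanSpace ℝ (Fin d))) (Ω : Set (EuclideanSpace ℝ (Fin d)))
    (s : EuclideanSpace ℝ (Fin d)) : ℝ :=
  sInf {h : ℝ | μ (Ω ∩ {x | inner ℝ x s ≤ h}) = μ Ω / 2 ∧ μ (Ω ∩ {x | h < inner ℝ x s}) = μ Ω / 2}

/-- The number `∑_α i_α / 3^α` of a binary word `i₀ i₁ ⋯ iₘ`. -/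
def wordCode (w : List Bool) : ℝ :=
  ∑ α ∈ Finset.range w.length, (if w.getD α false then 1 else 0) / (3 : ℝ) ^ α

namespace SlicingSchedule

variable {d : ℕ}

/-- `S.cell μ k w` is the set `Ω_w` of the partition of `μ`, for `w` among the labels present after
`k` steps. (For a word that has not yet appeared the value is irrelevant.) -/
def cell (S : SlicingSchedule d) (μ : Measure (EuclideanSpace ℝ (Fin d))) :
    ℕ → List Bool → Set (EuclideanSpace ℝ (Fin d))
  | 0, _ => Set.univ
  | k + 1, w =>
      if w = S.label k ++ [false] then
        S.cell μ k (S.label k) ∩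
          {x | inner ℝ x (S.dir k) ≤ cutLevel μ (S.cell μ k (S.label k)) (S.dir k)}
      else if w = S.label k ++ [true] then
        S.cell μ k (S.label k) ∩
          {x | cutLevel μ (S.cell μ k (S.label k)) (S.dir k) < inner ℝ x (S.dir k)}
      else S.cell μ k w

/-- The function with the value `wordCode w` on each set `Ω_w` of the partition after `k` steps. -/
def levelFun (S : SlicingSchedule d) (μ : Measure (EuclideanSpace ℝ (Fin d))) (k : ℕ)
    (x : EuclideanSpace ℝ (Fin d)) : ℝ :=
  ∑ w ∈ activeLabels S.label k, (S.cell μ k w).indicator (fun _ => wordCode w) x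

/-- The limit of the functions `levelFun`. -/
def limitFun (S : SlicingSchedule d) (μ : Measure (EuclideanSpace ℝ (Fin d)))
    (x : EuclideanSpace ℝ (Fin d)) : ℝ :=
  limUnder atTop (fun k => S.levelFun μ k x)

open Classical in
/-- The no-collision map from `μ` to `ν`: it sends `x` to the unique point `y` in the interior of the
support of `ν` with `limitFun ν y = limitFun μ x`. (Where there is no such unique `y` the value is
`0`.) -/
def noCollisionMap (S : SlicingSchedule d) (μ ν : Measure (EuclideanSpace ℝ (Fin d)))
    (x : EuclideanSpace ℝ (Fin d)) : EuclideanSpace ℝ (Fin d) :=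
  if h : ∃! y, y ∈ interior ν.support ∧ S.limitFun ν y = S.limitFun μ x then h.choose else 0

/-- The no-collision distance `W_{S,p}(μ, ν) = (∫ |t(x) - x|^p dμ(x))^{1/p}`, where `t` is the
no-collision map from `μ` to `ν`. -/
def noCollisionDist (S : SlicingSchedule d) (p : ℝ) (μ ν : Measure (EuclideanSpace ℝ (Fin d))) :
    ℝ≥0∞ :=
  (∫⁻ x, (edist (S.noCollisionMap μ ν x) x) ^ p ∂μ) ^ (1 / p)

/-- All slicing directions belong to one basis `e` of `ℝ^d`, and each set that appears is
divided in each of the directions `e i` infinitely many times: along every infinite sequence of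
successive labels `i₀, i₀i₁, i₀i₁i₂, …` each `e i` occurs infinitely often as slicing direction. -/
def Admissible (S : SlicingSchedule d) : Prop :=
  ∃ e : Module.Basis (Fin d) ℝ (EuclideanSpace ℝ (Fin d)),
    (∀ k, ∃ i, S.dir k = e i) ∧
    ∀ β : ℕ → Bool, β 0 = false → ∀ i,
      {k : ℕ | (∃ m : ℕ, S.label k = (List.range m).map β) ∧ S.dir k = e i}.Infinite

/-- All slicing directions are parallel to coordinate axes. -/
def AxisParallel (S : SlicingSchedule d) : Prop :=
  ∀ k, ∃ (j : Fin d) (c : ℝ), S.dir k = c • EuclideanSpace.single j (1 : ℝ)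

end SlicingSchedule

/-- The elliptical domain with centre `u` and semi-axes `a` and `b`. -/
def ellipse (a b : ℝ) (u : EuclideanSpace ℝ (Fin 2)) : Set (EuclideanSpace ℝ (Fin 2)) :=
  {x | (x 0 - u 0) ^ 2 / a ^ 2 + (x 1 - u 1) ^ 2 / b ^ 2 ≤ 1}

/-- The uniform probability measure on a planar set of positive finite area. -/
def uniformMeasure (A : Set (EuclideanSpace ℝ (Fin 2))) : Measure (EuclideanSpace ℝ (Fin 2)) :=
  ProbabilityTheory.cond volume A

/-- The counter-clockwise rotation by the angle `t` around the origin. -/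
def planeRotation (t : ℝ) (x : EuclideanSpace ℝ (Fin 2)) : EuclideanSpace ℝ (Fin 2) :=
  !₂[x 0 * Real.cos t - x 1 * Real.sin t, x 0 * Real.sin t + x 1 * Real.cos t]

/-- The set of the rotations `μ_t` of a measure, `t ∈ [0, 2π]`. -/
def rotationFamily (μ : Measure (EuclideanSpace ℝ (Fin 2))) :
    Set (Measure (EuclideanSpace ℝ (Fin 2))) :=
  (fun t : ℝ => μ.map (planeRotation t)) '' Set.Icc 0 (2 * Real.pi)

/-- The set `M` with the distance `D` is isometric to a planar circle `{x : |x| = r}`, `r > 0`, with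
the Euclidean distance. -/
def IsometricToCircle {X : Type*} (M : Set X) (D : X → X → ℝ≥0∞) : Prop :=
  ∃ r : ℝ, 0 < r ∧ ∃ f : M ≃ Metric.sphere (0 : EuclideanSpace ℝ (Fin 2)) r,
    ∀ μ ν : M, edist (f μ) (f ν) = D μ ν

end

/-!
Translates of two centred measures have squared no-collision distance `c + |v - w|²`, where `v` and
`w` are the translation vectors and `c` is the squared distance of the centred measures
(`noCollisionDist_map_add`). The cuts move along with the measure, so the no-collision map of the
translates is the conjugated one, and the mixed term vanishes because the no-collision map pushes
the first measure forward to the second one (`map_noCollisionMap`), so that the mean displacement of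
centred measures is zero.

The push-forward property is a consequence of two facts. The limit code `ℓ^μ` has the same
distribution for all absolutely continuous `μ`, since a cell carries a mass that depends on its
label only (`map_limitFun_eq`). And `ℓ^ν` is injective on the interior of the support of the uniform
measure on a convex body (`injOn_limitFun`), so that by the Lusin–Souslin theorem it has a
measurable inverse there. Injectivity is the geometric core (`coord_eq_of_address_eq`): the cells
are boxes, and if the cells around `x` did not shrink to a point in some coordinate direction, then
each of the infinitely many cuts in this direction would remove a slab of a width that is bounded
below.

For `a = b` the measures `μ_t` are the translates of the uniform measure on a centred disc by the
vectors of length `|u|`, and the constant `c` is zero, so that translation vectors give the isometry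
with the circle of radius `|u|`.

For `a ≠ b` an isometry with a circle is excluded by looking at the pairs `μ_t`, `μ_{t+π}`, which
are translates of each other at distance `2|u|`. If `m_t` is the midpoint of the images of `μ_t` and
`μ_{t+π}`, then elementary geometry in the plane (`chord_midpoints`) shows `m_s = -m_t ≠ m_t`
whenever the ellipses rotated by `s` and `t` are not translates of each other. This cannot hold for
all pairs among three angles that give three different shapes, such as `0`, `π / 4`, `π / 2`.
-/

open scoped ProbabilityTheory

/-! ### Words and their ternary codes -/

/-- No label present after `k` steps is a proper initial segment of another one, so a word that is
present is never of the form `label k ++ [i]`. -/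
theorem activeLabels_prefixFree {b : ℕ → List Bool}
    (hb : ∀ k, b k ∈ activeLabels b k) (k : ℕ) :
    ∀ w ∈ activeLabels b k, ∀ w' ∈ activeLabels b k, w <+: w' → w = w' := by
  induction k with
  | zero =>
    intro w hw w' hw' _
    simp only [activeLabels, Finset.mem_singleton] at hw hw'
    rw [hw, hw']
  | succ k ih =>
    intro w hw w' hw' hp
    simp only [activeLabels, Finset.mem_union, Finset.mem_erase, Finset.mem_insert,
      Finset.mem_singleton] at hw hw'
    have hlen : ∀ i j : Bool, b k ++ [i] <+: b k ++ [j] → b k ++ [i] = b k ++ [j] := fun i j h =>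
      h.eq_of_length (by simp)
    have hnew : (w = b k ++ [false] ∨ w = b k ++ [true]) ↔ ∃ i, w = b k ++ [i] := by simp
    have hnew' : (w' = b k ++ [false] ∨ w' = b k ++ [true]) ↔ ∃ i, w' = b k ++ [i] := by simp
    rw [hnew] at hw
    rw [hnew'] at hw'
    rcases hw with ⟨hne, hw⟩ | ⟨i, rfl⟩ <;> rcases hw' with ⟨hne', hw'⟩ | ⟨j, rfl⟩
    · exact ih w hw w' hw' hp
    · rcases List.prefix_concat_iff.mp hp with h | h
      · exact h
      · exact absurd (ih w hw _ (hb k) h) hne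
    · exact absurd (ih _ (hb k) w' hw' ((List.prefix_append _ _).trans hp)).symm hne'
    · exact hlen i j hp

theorem wordCode_concat (w : List Bool) (i : Bool) :
    wordCode (w ++ [i]) = wordCode w + (if i then 1 else 0) / (3 : ℝ) ^ w.length := by
  unfold wordCode
  rw [List.length_append, List.length_singleton, Finset.sum_range_succ]
  congr 1
  · refine Finset.sum_congr rfl fun α hα => ?_
    rw [List.getD_append _ _ _ _ (Finset.mem_range.mp hα)]
  · simp

theorem wordCode_le_append (w v : List Bool) : wordCode w ≤ wordCode (w ++ v) := by
  induction v using List.reverseRecOn with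
  | nil => simp
  | append_singleton v i ih =>
    rw [← List.append_assoc, wordCode_concat]
    have : (0 : ℝ) ≤ (if i then 1 else 0) / (3 : ℝ) ^ (w ++ v).length := by
      split_ifs <;> positivity
    linarith

/-- The letters that follow `w` contribute at most `∑_{α ≥ |w|} 3^{-α} = 3/2 · 3^{-|w|}`. -/
theorem wordCode_append_le (w v : List Bool) :
    wordCode (w ++ v) ≤ wordCode w + 3 / 2 / (3 : ℝ) ^ w.length := by
  -- the strengthened bound that carries the induction on `v`
  have key : wordCode (w ++ v) + 3 / 2 / (3 : ℝ) ^ (w ++ v).length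
      ≤ wordCode w + 3 / 2 / (3 : ℝ) ^ w.length := by
    induction v using List.reverseRecOn with
    | nil => simp
    | append_singleton v i ih =>
      rw [← List.append_assoc, wordCode_concat, List.length_append (bs := [i]),
        List.length_singleton, pow_succ]
      have h3 : (0 : ℝ) < 1 / (3 : ℝ) ^ (w ++ v).length := by positivity
      have : (if i then 1 else 0) / (3 : ℝ) ^ (w ++ v).length
          ≤ 1 / (3 : ℝ) ^ (w ++ v).length := by
        gcongr
        split_ifs <;> norm_num
      have e1 : 3 / 2 / ((3 : ℝ) ^ (w ++ v).length * 3)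
          = 1 / 2 * (1 / (3 : ℝ) ^ (w ++ v).length) := by field_simp
      have e2 : 3 / 2 / (3 : ℝ) ^ (w ++ v).length
          = 3 / 2 * (1 / (3 : ℝ) ^ (w ++ v).length) := by field_simp
      linarith
  have : (0 : ℝ) ≤ 3 / 2 / (3 : ℝ) ^ (w ++ v).length := by positivity
  linarith

namespace SlicingSchedule

variable {d : ℕ}

/-! ### Addresses of points -/

theorem mem_activeLabels_succ (S : SlicingSchedule d) {k : ℕ} {w : List Bool} :
    w ∈ activeLabels S.label (k + 1) ↔
      (w ≠ S.label k ∧ w ∈ activeLabels S.label k) ∨ ∃ i, w = S.label k ++ [i] := by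
  simp only [activeLabels, Finset.mem_union, Finset.mem_erase, Finset.mem_insert,
    Finset.mem_singleton, Bool.exists_bool]

theorem append_notMem_activeLabels (S : SlicingSchedule d) (k : ℕ) (i : Bool) :
    S.label k ++ [i] ∉ activeLabels S.label k := fun h => by
  have := activeLabels_prefixFree S.label_mem k _ (S.label_mem k) _ h (List.prefix_append _ _)
  simp at this

theorem cell_succ_false (S : SlicingSchedule d) (μ : Measure (EuclideanSpace ℝ (Fin d))) (k : ℕ) :
    S.cell μ (k + 1) (S.label k ++ [false]) = S.cell μ k (S.label k) ∩
      {x | inner ℝ x (S.dir k) ≤ cutLevel μ (S.cell μ k (S.label k)) (S.dir k)} := by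
  simp [cell]

theorem cell_succ_true (S : SlicingSchedule d) (μ : Measure (EuclideanSpace ℝ (Fin d))) (k : ℕ) :
    S.cell μ (k + 1) (S.label k ++ [true]) = S.cell μ k (S.label k) ∩
      {x | cutLevel μ (S.cell μ k (S.label k)) (S.dir k) < inner ℝ x (S.dir k)} := by
  simp [cell]

theorem cell_succ_of_mem (S : SlicingSchedule d) (μ : Measure (EuclideanSpace ℝ (Fin d))) {k : ℕ}
    {w : List Bool} (hw : w ∈ activeLabels S.label k) :
    S.cell μ (k + 1) w = S.cell μ k w := by
  have h (i : Bool) : w ≠ S.label k ++ [i] := fun h =>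
    S.append_notMem_activeLabels k i (h ▸ hw)
  simp [cell, h]

/-- The label of the set of the partition of `μ` after `k` steps that contains `x`. -/
noncomputable def address (S : SlicingSchedule d) (μ : Measure (EuclideanSpace ℝ (Fin d)))
    (x : EuclideanSpace ℝ (Fin d)) : ℕ → List Bool
  | 0 => [false]
  | k + 1 =>
      if S.address μ x k = S.label k then
        S.label k ++ [decide (cutLevel μ (S.cell μ k (S.label k)) (S.dir k) < inner ℝ x (S.dir k))]
      else S.address μ x k

variable (S : SlicingSchedule d) (μ : Measure (EuclideanSpace ℝ (Fin d)))

theorem address_mem (x : EuclideanSpace ℝ (Fin d)) (k : ℕ) :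
    S.address μ x k ∈ activeLabels S.label k := by
  induction k with
  | zero => simp [address, activeLabels]
  | succ k ih =>
    rw [mem_activeLabels_succ, address]
    split_ifs with h
    · exact Or.inr ⟨_, rfl⟩
    · exact Or.inl ⟨h, ih⟩

theorem mem_cell_iff (x : EuclideanSpace ℝ (Fin d)) (k : ℕ) :
    ∀ w ∈ activeLabels S.label k, (x ∈ S.cell μ k w ↔ S.address μ x k = w) := by
  induction k with
  | zero =>
    intro w hw
    simp only [activeLabels, Finset.mem_singleton] at hw
    simp [cell, address, hw]
  | succ k ih =>
    intro w hw
    have hL := ih _ (S.label_mem k)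
    have hn (i : Bool) : S.address μ x k ≠ S.label k ++ [i] := fun h =>
      S.append_notMem_activeLabels k i (h ▸ S.address_mem μ x k)
    rcases S.mem_activeLabels_succ.mp hw with ⟨hne, hw'⟩ | ⟨i, rfl⟩
    · rw [S.cell_succ_of_mem μ hw', ih _ hw', address]
      split_ifs with h
      · constructor
        · intro h'
          exact absurd (h'.symm.trans h) hne
        · intro h'
          exact absurd (h' ▸ hw') (S.append_notMem_activeLabels k _)
      · rfl
    · rw [address]
      cases i
      · rw [cell_succ_false, Set.mem_inter_iff, hL]
        split_ifs with h <;> simp [h, hn]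
      · rw [cell_succ_true, Set.mem_inter_iff, hL]
        split_ifs with h <;> simp [h, hn]

theorem mem_cell_address (x : EuclideanSpace ℝ (Fin d)) (k : ℕ) :
    x ∈ S.cell μ k (S.address μ x k) :=
  (S.mem_cell_iff μ x k _ (S.address_mem μ x k)).mpr rfl

theorem address_prefix_succ (x : EuclideanSpace ℝ (Fin d)) (k : ℕ) :
    S.address μ x k <+: S.address μ x (k + 1) := by
  rw [address]
  split_ifs with h
  · rw [h]
    exact List.prefix_append _ _
  · exact List.prefix_refl _

theorem address_prefix (x : EuclideanSpace ℝ (Fin d)) {k l : ℕ} (h : k ≤ l) :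
    S.address μ x k <+: S.address μ x l := by
  induction l, h using Nat.le_induction with
  | base => exact List.prefix_refl _
  | succ l _ ih => exact ih.trans (S.address_prefix_succ μ x l)

/-- A function of the word that labels the set containing `x` is the sum over the sets of the
partition that defines `levelFun`. -/
theorem sum_indicator_cell (φ : List Bool → ℝ) (k : ℕ) (x : EuclideanSpace ℝ (Fin d)) :
    ∑ w ∈ activeLabels S.label k, (S.cell μ k w).indicator (fun _ => φ w) x
      = φ (S.address μ x k) := by
  classical
  rw [Finset.sum_eq_single_of_mem _ (S.address_mem μ x k)]
  · rw [Set.indicator_of_mem (S.mem_cell_address μ x k)]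
  · intro w hw hne
    rw [Set.indicator_of_notMem]
    rw [S.mem_cell_iff μ x k w hw]
    exact hne.symm

theorem levelFun_eq (k : ℕ) (x : EuclideanSpace ℝ (Fin d)) :
    S.levelFun μ k x = wordCode (S.address μ x k) :=
  S.sum_indicator_cell μ wordCode k x

theorem tendsto_levelFun (x : EuclideanSpace ℝ (Fin d)) :
    Tendsto (fun k => S.levelFun μ k x) atTop (𝓝 (S.limitFun μ x)) := by
  have hmono : Monotone fun k => S.levelFun μ k x := by
    intro k l h
    simp only [levelFun_eq]
    obtain ⟨v, hv⟩ := S.address_prefix μ x h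
    rw [← hv]
    exact wordCode_le_append _ _
  have hbdd : BddAbove (Set.range fun k => S.levelFun μ k x) := by
    refine ⟨wordCode [] + 3 / 2 / (3 : ℝ) ^ ([] : List Bool).length, ?_⟩
    rintro _ ⟨k, rfl⟩
    simp only [levelFun_eq]
    exact wordCode_append_le [] _
  have := tendsto_atTop_ciSup hmono hbdd
  rw [limitFun, this.limUnder_eq]
  exact this

theorem wordCode_le_limitFun (k : ℕ) (x : EuclideanSpace ℝ (Fin d)) :
    wordCode (S.address μ x k) ≤ S.limitFun μ x := by
  refine ge_of_tendsto (S.tendsto_levelFun μ x) ?_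
  filter_upwards [eventually_ge_atTop k] with l hl
  obtain ⟨v, hv⟩ := S.address_prefix μ x hl
  rw [levelFun_eq, ← hv]
  exact wordCode_le_append _ _

theorem limitFun_le_wordCode (k : ℕ) (x : EuclideanSpace ℝ (Fin d)) :
    S.limitFun μ x ≤ wordCode (S.address μ x k) + 3 / 2 / (3 : ℝ) ^ (S.address μ x k).length := by
  refine le_of_tendsto (S.tendsto_levelFun μ x) ?_
  filter_upwards [eventually_ge_atTop k] with l hl
  obtain ⟨v, hv⟩ := S.address_prefix μ x hl
  rw [levelFun_eq, ← hv]
  exact wordCode_append_le _ _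

/-- Two points that are separated at some step have different limit codes, because
`∑_{α > m} 3^{-α} < 3^{-m}`. -/
theorem address_eq_of_limitFun_eq {x y : EuclideanSpace ℝ (Fin d)}
    (h : S.limitFun μ x = S.limitFun μ y) (k : ℕ) : S.address μ x k = S.address μ y k := by
  induction k with
  | zero => rfl
  | succ k ih =>
    have key : ∀ x y : EuclideanSpace ℝ (Fin d), S.limitFun μ x = S.limitFun μ y →
        S.address μ x (k + 1) = S.label k ++ [false] →
        S.address μ y (k + 1) = S.label k ++ [true] → False := by
      intro x y h hx hy
      have h1 := S.limitFun_le_wordCode μ (k + 1) x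
      have h2 := S.wordCode_le_limitFun μ (k + 1) y
      rw [hx, wordCode_concat, List.length_append, List.length_singleton, pow_succ] at h1
      rw [hy, wordCode_concat] at h2
      have h3 : (0 : ℝ) < 1 / (3 : ℝ) ^ (S.label k).length := by positivity
      have e1 : 3 / 2 / ((3 : ℝ) ^ (S.label k).length * 3)
          = 1 / 2 * (1 / (3 : ℝ) ^ (S.label k).length) := by field_simp
      simp only [Bool.false_eq_true, if_false, if_true, zero_div] at h1 h2
      linarith
    by_cases hk : S.address μ x k = S.label k
    · have hx : ∃ i, S.address μ x (k + 1) = S.label k ++ [i] := by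
        rw [address, if_pos hk]
        exact ⟨_, rfl⟩
      have hy : ∃ i, S.address μ y (k + 1) = S.label k ++ [i] := by
        rw [address, if_pos (ih ▸ hk)]
        exact ⟨_, rfl⟩
      obtain ⟨i, hi⟩ := hx
      obtain ⟨j, hj⟩ := hy
      cases i <;> cases j
      · rw [hi, hj]
      · exact (key x y h hi hj).elim
      · exact (key y x h.symm hj hi).elim
      · rw [hi, hj]
    · rw [address, address, if_neg hk, if_neg (ih ▸ hk), ih]

end SlicingSchedule

/-! ### Halving cuts and the distribution of the limit code -/

theorem ae_inner_ne {d : ℕ} {μ : Measure (EuclideanSpace ℝ (Fin d))}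
    (hμ : μ ≪ volume) {s : EuclideanSpace ℝ (Fin d)} (hs : ‖s‖ = 1) (h : ℝ) :
    ∀ᵐ x ∂μ, inner ℝ x s ≠ h := by
  refine hμ.ae_le ?_
  have hsurj : Function.Surjective (innerSL ℝ s).toLinearMap := by
    intro t
    refine ⟨t • s, ?_⟩
    simp [hs]
  have := (ae_comp_linearMap_mem_iff (innerSL ℝ s).toLinearMap volume volume hsurj
    (s := {t : ℝ | t ≠ h}) (measurableSet_singleton h).compl).mpr (by
      rw [ae_iff]
      simp)
  filter_upwards [this] with x hx
  rw [real_inner_comm]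
  exact hx

theorem measurableSet_inner_le {d : ℕ} (s : EuclideanSpace ℝ (Fin d)) (h : ℝ) :
    MeasurableSet {x : EuclideanSpace ℝ (Fin d) | inner ℝ x s ≤ h} :=
  measurableSet_le (by fun_prop) measurable_const

theorem measurableSet_lt_inner {d : ℕ} (s : EuclideanSpace ℝ (Fin d)) (h : ℝ) :
    MeasurableSet {x : EuclideanSpace ℝ (Fin d) | h < inner ℝ x s} :=
  measurableSet_lt measurable_const (by fun_prop)

/-- Convergence of the masses of half-spaces, along any filter along which membership in the
half-space is eventually constant for almost every point. -/
theorem tendsto_measureReal_halfspace {d : ℕ} {μ : Measure (EuclideanSpace ℝ (Fin d))}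
    [IsFiniteMeasure μ] {Ω : Set (EuclideanSpace ℝ (Fin d))}
    {s : EuclideanSpace ℝ (Fin d)} {l : Filter ℝ} [l.IsCountablyGenerated]
    {A : Set (EuclideanSpace ℝ (Fin d))} (hA : MeasurableSet A)
    (h : ∀ᵐ x ∂μ, ∀ᶠ t in l, (inner ℝ x s ≤ t ↔ x ∈ A)) :
    Tendsto (fun t => μ.real (Ω ∩ {x | inner ℝ x s ≤ t})) l (𝓝 (μ.real (Ω ∩ A))) := by
  have e (B : Set (EuclideanSpace ℝ (Fin d))) (hB : MeasurableSet B) :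
      μ.real (Ω ∩ B) = ∫ x in Ω, B.indicator 1 x ∂μ := by
    rw [integral_indicator_one hB, measureReal_restrict_apply hB, Set.inter_comm]
  simp_rw [e _ hA, e _ (measurableSet_inner_le s _)]
  refine tendsto_integral_filter_of_dominated_convergence (fun _ => 1) ?_ ?_
    (integrable_const _) ?_
  · exact Eventually.of_forall fun t =>
      (measurable_one.indicator (measurableSet_inner_le s t)).aestronglyMeasurable
  · refine Eventually.of_forall fun t => Eventually.of_forall fun x => ?_
    by_cases hx : x ∈ {x : EuclideanSpace ℝ (Fin d) | inner ℝ x s ≤ t} <;> simp [hx]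
  · filter_upwards [ae_restrict_of_ae h] with x hx
    refine tendsto_const_nhds.congr' ?_
    filter_upwards [hx] with t ht
    by_cases hxA : x ∈ A <;> simp [ht, hxA]

theorem halving_iff {d : ℕ} {μ : Measure (EuclideanSpace ℝ (Fin d))} [IsFiniteMeasure μ]
    {Ω : Set (EuclideanSpace ℝ (Fin d))}
    (s : EuclideanSpace ℝ (Fin d)) (h : ℝ) :
    (μ (Ω ∩ {x | inner ℝ x s ≤ h}) = μ Ω / 2 ∧ μ (Ω ∩ {x | h < inner ℝ x s}) = μ Ω / 2) ↔
      μ.real (Ω ∩ {x | inner ℝ x s ≤ h}) = μ.real Ω / 2 := by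
  have hadd := measure_inter_add_sdiff (μ := μ) Ω (measurableSet_inner_le s h)
  have hdiff : Ω \ {x | inner ℝ x s ≤ h} = Ω ∩ {x | h < inner ℝ x s} := by
    ext x
    simp
  rw [hdiff] at hadd
  constructor
  · rintro ⟨h1, -⟩
    simp [measureReal_def, h1]
  · intro h1
    have h1' : μ (Ω ∩ {x | inner ℝ x s ≤ h}) = μ Ω / 2 := by
      rw [← ENNReal.toReal_eq_toReal_iff' (measure_ne_top _ _)
        (ENNReal.div_ne_top (measure_ne_top _ _) (by simp))]
      simpa [measureReal_def] using h1
    refine ⟨h1', ?_⟩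
    rw [h1'] at hadd
    have htop : μ Ω / 2 ≠ ∞ := ENNReal.div_ne_top (measure_ne_top _ _) (by simp)
    rw [← ENNReal.add_halves (μ Ω)] at hadd
    rw [ENNReal.add_halves] at hadd
    nth_rewrite 2 [← ENNReal.add_halves (μ Ω)] at hadd
    exact (ENNReal.add_right_inj htop).mp hadd

/-- For a set of positive mass the cut level is attained. -/
theorem isLeast_cutLevel {d : ℕ} {μ : Measure (EuclideanSpace ℝ (Fin d))}
    [IsFiniteMeasure μ] (hμ : μ ≪ volume) {Ω : Set (EuclideanSpace ℝ (Fin d))}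
    (h0 : μ Ω ≠ 0) {s : EuclideanSpace ℝ (Fin d)} (hs : ‖s‖ = 1) :
    IsLeast {h : ℝ | μ (Ω ∩ {x | inner ℝ x s ≤ h}) = μ Ω / 2 ∧
      μ (Ω ∩ {x | h < inner ℝ x s}) = μ Ω / 2} (cutLevel μ Ω s) := by
  have hpos : 0 < μ.real Ω := ENNReal.toReal_pos h0 (measure_ne_top _ _)
  have hcont : Continuous fun t => μ.real (Ω ∩ {x | inner ℝ x s ≤ t}) := by
    refine continuous_iff_continuousAt.mpr fun t => ?_
    refine tendsto_measureReal_halfspace (measurableSet_inner_le s t) ?_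
    filter_upwards [ae_inner_ne hμ hs t] with x hx
    rcases lt_or_gt_of_ne hx with h | h
    · filter_upwards [lt_mem_nhds h] with t' ht'
      exact iff_of_true ht'.le h.le
    · filter_upwards [gt_mem_nhds h] with t' ht'
      exact iff_of_false (not_le.mpr ht') (not_le.mpr h)
  have htop : Tendsto (fun t => μ.real (Ω ∩ {x | inner ℝ x s ≤ t})) atTop (𝓝 (μ.real Ω)) := by
    have := tendsto_measureReal_halfspace (μ := μ) (Ω := Ω) (s := s) (l := atTop)
      (A := Set.univ) MeasurableSet.univ (Eventually.of_forall fun x => by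
        filter_upwards [eventually_ge_atTop (inner ℝ x s)] with t ht
        simpa using ht)
    simpa using this
  have hbot : Tendsto (fun t => μ.real (Ω ∩ {x | inner ℝ x s ≤ t})) atBot (𝓝 0) := by
    have := tendsto_measureReal_halfspace (μ := μ) (Ω := Ω) (s := s) (l := atBot)
      (A := ∅) MeasurableSet.empty (Eventually.of_forall fun x => by
        filter_upwards [eventually_lt_atBot (inner ℝ x s)] with t ht
        simpa using ht)
    simpa using this
  obtain ⟨t₁, ht₁⟩ := (htop.eventually (lt_mem_nhds (half_lt_self hpos))).exists
  obtain ⟨t₀, ht₀⟩ := (hbot.eventually (gt_mem_nhds (half_pos hpos))).exists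
  have hmono : Monotone fun t => μ.real (Ω ∩ {x | inner ℝ x s ≤ t}) := fun t t' h =>
    measureReal_mono (Set.inter_subset_inter_right _ fun x (hx : _ ≤ t) => hx.trans h)
  rw [cutLevel]
  simp_rw [halving_iff]
  refine IsClosed.isLeast_csInf ?_ ?_ ?_
  · exact isClosed_eq hcont continuous_const
  · exact intermediate_value_univ t₀ t₁ hcont ⟨ht₀.le, ht₁.le⟩
  · refine ⟨t₀, fun t (ht : _ = _) => ?_⟩
    by_contra! hlt
    have := hmono hlt.le
    simp only [ht] at this
    linarith

/-- The cut level always halves the mass: for a null set every level does, including the junk value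
of `cutLevel`. -/
theorem cutLevel_spec {d : ℕ} {μ : Measure (EuclideanSpace ℝ (Fin d))}
    [IsFiniteMeasure μ] (hμ : μ ≪ volume) (Ω : Set (EuclideanSpace ℝ (Fin d)))
    {s : EuclideanSpace ℝ (Fin d)} (hs : ‖s‖ = 1) :
    μ (Ω ∩ {x | inner ℝ x s ≤ cutLevel μ Ω s}) = μ Ω / 2 ∧
      μ (Ω ∩ {x | cutLevel μ Ω s < inner ℝ x s}) = μ Ω / 2 := by
  by_cases h0 : μ Ω = 0
  · simp [h0, measure_mono_null Set.inter_subset_left h0]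
  · exact (isLeast_cutLevel hμ h0 hs).1

namespace SlicingSchedule

variable {d : ℕ} (S : SlicingSchedule d) {μ ν : Measure (EuclideanSpace ℝ (Fin d))}

theorem measurableSet_cell (μ : Measure (EuclideanSpace ℝ (Fin d))) (k : ℕ) (w : List Bool) :
    MeasurableSet (S.cell μ k w) := by
  induction k generalizing w with
  | zero => exact MeasurableSet.univ
  | succ k ih =>
    rw [cell]
    split_ifs
    · exact (ih _).inter (measurableSet_inner_le _ _)
    · exact (ih _).inter (measurableSet_lt_inner _ _)
    · exact ih _

theorem measure_cell [IsProbabilityMeasure μ] (hμ : μ ≪ volume) (k : ℕ) :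
    ∀ w ∈ activeLabels S.label k, μ (S.cell μ k w) = 2 * 2⁻¹ ^ w.length := by
  induction k with
  | zero =>
    intro w hw
    simp only [activeLabels, Finset.mem_singleton] at hw
    simp [cell, hw, ENNReal.mul_inv_cancel]
  | succ k ih =>
    intro w hw
    rcases S.mem_activeLabels_succ.mp hw with ⟨-, hw'⟩ | ⟨i, rfl⟩
    · rw [S.cell_succ_of_mem μ hw', ih w hw']
    · have h := cutLevel_spec hμ (S.cell μ k (S.label k)) (S.norm_dir k)
      rw [ih _ (S.label_mem k), div_eq_mul_inv, mul_assoc, ← pow_succ] at h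
      rw [List.length_append, List.length_singleton]
      cases i
      · rw [cell_succ_false, h.1]
      · rw [cell_succ_true, h.2]

theorem measure_cell_ne_zero [IsProbabilityMeasure μ] (hμ : μ ≪ volume) {k : ℕ} {w : List Bool}
    (hw : w ∈ activeLabels S.label k) : μ (S.cell μ k w) ≠ 0 := by
  rw [S.measure_cell hμ k w hw]
  simp

theorem measurable_levelFun (μ : Measure (EuclideanSpace ℝ (Fin d))) (k : ℕ) :
    Measurable (S.levelFun μ k) :=
  Finset.measurable_fun_sum _ fun w _ => measurable_const.indicator (S.measurableSet_cell μ k w)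

theorem measurable_limitFun (μ : Measure (EuclideanSpace ℝ (Fin d))) :
    Measurable (S.limitFun μ) :=
  measurable_of_tendsto_metrizable (S.measurable_levelFun μ)
    (tendsto_pi_nhds.mpr (S.tendsto_levelFun μ))

theorem integral_levelFun [IsProbabilityMeasure μ] (hμ : μ ≪ volume) (φ : ℝ → ℝ) (k : ℕ) :
    ∫ x, φ (S.levelFun μ k x) ∂μ =
      ∑ w ∈ activeLabels S.label k, (2 * 2⁻¹ ^ w.length : ℝ≥0∞).toReal * φ (wordCode w) := by
  have e (x) : φ (S.levelFun μ k x) = ∑ w ∈ activeLabels S.label k,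
      (S.cell μ k w).indicator (fun _ => φ (wordCode w)) x := by
    rw [levelFun_eq, S.sum_indicator_cell μ fun w => φ (wordCode w)]
  simp_rw [e]
  rw [integral_finsetSum]
  · refine Finset.sum_congr rfl fun w hw => ?_
    rw [integral_indicator_const _ (S.measurableSet_cell μ k w), measureReal_def,
      S.measure_cell hμ k w hw, smul_eq_mul]
  · intro w _
    exact (integrable_const _).indicator (S.measurableSet_cell μ k w)

/-- The limit code has the same distribution under all absolutely continuous probability
measures: the mass of the cell labelled `w` depends on `w` only. -/
theorem map_limitFun_eq [IsProbabilityMeasure μ] [IsProbabilityMeasure ν] (hμ : μ ≪ volume)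
    (hν : ν ≪ volume) : μ.map (S.limitFun μ) = ν.map (S.limitFun ν) := by
  have := Measure.isProbabilityMeasure_map (μ := μ) (S.measurable_limitFun μ).aemeasurable
  have := Measure.isProbabilityMeasure_map (μ := ν) (S.measurable_limitFun ν).aemeasurable
  refine ext_of_forall_integral_eq_of_IsFiniteMeasure fun φ => ?_
  rw [integral_map (S.measurable_limitFun μ).aemeasurable
      φ.continuous.aestronglyMeasurable,
    integral_map (S.measurable_limitFun ν).aemeasurable φ.continuous.aestronglyMeasurable]
  have key {μ : Measure (EuclideanSpace ℝ (Fin d))} [IsProbabilityMeasure μ] :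
      Tendsto (fun k => ∫ x, φ (S.levelFun μ k x) ∂μ) atTop
        (𝓝 (∫ x, φ (S.limitFun μ x) ∂μ)) := by
    refine tendsto_integral_of_dominated_convergence (fun _ => ‖φ‖) ?_ (integrable_const _) ?_ ?_
    · exact fun k => (φ.continuous.measurable.comp
        (S.measurable_levelFun μ k)).aestronglyMeasurable
    · exact fun k => Eventually.of_forall fun x => φ.norm_coe_le_norm _
    · exact Eventually.of_forall fun x => (φ.continuous.tendsto _).comp (S.tendsto_levelFun μ x)
  refine tendsto_nhds_unique (key (μ := μ)) ?_
  simp_rw [S.integral_levelFun hμ φ, ← S.integral_levelFun hν φ]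
  exact key

end SlicingSchedule

/-! ### Admissible axis-parallel schedules separate points -/

namespace SlicingSchedule

variable {d : ℕ} (S : SlicingSchedule d) (μ : Measure (EuclideanSpace ℝ (Fin d)))

/-- All addresses of a point are initial segments of one infinite word. -/
theorem exists_forall_address_eq (x : EuclideanSpace ℝ (Fin d)) :
    ∃ β : ℕ → Bool, β 0 = false ∧
      ∀ k, S.address μ x k = (List.range (S.address μ x k).length).map β := by
  classical
  let β : ℕ → Bool := fun n => decide (∃ k, (S.address μ x k)[n]? = some true)
  have hβ : ∀ k n (hn : n < (S.address μ x k).length), (S.address μ x k)[n] = β n := by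
    intro k n hn
    have hcons : ∀ l c, (S.address μ x l)[n]? = some c → c = (S.address μ x k)[n] := by
      intro l c hl
      rcases le_total k l with h | h
      · obtain ⟨v, hv⟩ := S.address_prefix μ x h
        rw [← hv, List.getElem?_append_left hn, List.getElem?_eq_getElem hn] at hl
        exact (Option.some.inj hl).symm
      · obtain ⟨v, hv⟩ := S.address_prefix μ x h
        have hn' : n < (S.address μ x l).length := (List.getElem?_eq_some_iff.mp hl).1
        have : (S.address μ x k)[n]? = some c := by
          rw [← hv, List.getElem?_append_left hn', hl]
        rw [List.getElem?_eq_getElem hn] at this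
        exact (Option.some.inj this).symm
    cases hc : (S.address μ x k)[n] with
    | true =>
      refine (decide_eq_true ?_).symm
      exact ⟨k, by rw [List.getElem?_eq_getElem hn, hc]⟩
    | false =>
      refine (decide_eq_false ?_).symm
      rintro ⟨l, hl⟩
      have := hcons l true hl
      simp [hc] at this
  refine ⟨β, ?_, fun k => ?_⟩
  · rw [← hβ 0 0 (by simp [address])]
    simp [address]
  · refine List.ext_getElem (by simp) fun n h1 h2 => ?_
    rw [hβ k n h1]
    simp

variable {S} in
/-- The set containing a given point is divided infinitely many times in each coordinate
direction. -/
theorem Admissible.infinite_setOf_cut (hS : S.Admissible) (hS' : S.AxisParallel)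
    (x : EuclideanSpace ℝ (Fin d)) (j : Fin d) :
    ∃ c : ℝ, c ≠ 0 ∧ {k | S.address μ x k = S.label k ∧
      S.dir k = c • EuclideanSpace.single j (1 : ℝ)}.Infinite := by
  obtain ⟨e, he, hinf⟩ := hS
  obtain ⟨i, hi⟩ : ∃ i, e i j ≠ 0 := by
    by_contra! h
    have hzero : (EuclideanSpace.proj j : EuclideanSpace ℝ (Fin d) →L[ℝ] ℝ).toLinearMap = 0 :=
      e.ext fun i => by simpa using h i
    have := LinearMap.congr_fun hzero (EuclideanSpace.single j (1 : ℝ))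
    simp at this
  obtain ⟨β, hβ0, hβ⟩ := S.exists_forall_address_eq μ x
  have hset := hinf β hβ0 i
  obtain ⟨k₀, -, hk₀⟩ := hset.nonempty
  obtain ⟨j', c, hc⟩ := hS' k₀
  rw [hk₀] at hc
  have hjj : j = j' := by
    by_contra hne
    apply hi
    simp [hc, hne]
  subst hjj
  refine ⟨c, ?_, hset.mono ?_⟩
  · rintro rfl
    simp [hc] at hi
  · rintro k ⟨⟨m, hm⟩, hk⟩
    refine ⟨?_, by rw [hk, hc]⟩
    have hp : ∀ {m n : ℕ}, m ≤ n → (List.range m).map β <+: (List.range n).map β := by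
      intro m n h
      obtain ⟨r, rfl⟩ := Nat.exists_eq_add_of_le h
      rw [List.range_add, List.map_append]
      exact List.prefix_append _ _
    rcases le_total m (S.address μ x k).length with h | h
    · have := hp h
      rw [← hm, ← hβ k] at this
      exact (activeLabels_prefixFree S.label_mem k _ (S.label_mem k) _ (S.address_mem μ x k)
        this).symm
    · have := hp h
      rw [← hm, ← hβ k] at this
      exact activeLabels_prefixFree S.label_mem k _ (S.address_mem μ x k) _ (S.label_mem k) this

end SlicingSchedule

/-- The point `x` with its `i`-th coordinate replaced by `t`. -/
noncomputable def replaceCoord {d : ℕ} (x : EuclideanSpace ℝ (Fin d)) (i : Fin d) (t : ℝ) :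
    EuclideanSpace ℝ (Fin d) :=
  x + (t - x i) • EuclideanSpace.single i 1

section replaceCoord

variable {d : ℕ} (x : EuclideanSpace ℝ (Fin d)) (i : Fin d) (t : ℝ)

theorem replaceCoord_apply (j : Fin d) : replaceCoord x i t j = if j = i then t else x j := by
  by_cases h : j = i
  · subst h
    simp [replaceCoord]
  · simp [replaceCoord, h]

theorem replaceCoord_self : replaceCoord x i (x i) = x := by simp [replaceCoord]

theorem convex_preimage_replaceCoord {C : Set (EuclideanSpace ℝ (Fin d))} (hC : Convex ℝ C) :
    Convex ℝ (replaceCoord x i ⁻¹' C) := by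
  intro t ht t' ht' a b ha hb hab
  have : replaceCoord x i (a • t + b • t') = a • replaceCoord x i t + b • replaceCoord x i t' := by
    ext j
    simp only [PiLp.add_apply, PiLp.smul_apply, replaceCoord_apply, smul_eq_mul]
    split_ifs
    · rfl
    · rw [← add_mul, hab, one_mul]
  change replaceCoord x i (a • t + b • t') ∈ C
  rw [this]
  exact hC ht ht' ha hb hab

end replaceCoord

theorem inner_smul_single {d : ℕ} (x : EuclideanSpace ℝ (Fin d)) (c : ℝ) (j : Fin d) :
    inner ℝ x (c • EuclideanSpace.single j (1 : ℝ)) = c * x j := by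
  simp [inner_smul_right, EuclideanSpace.inner_single_right]

theorem volume_setOf_forall_mem {d : ℕ} {B : Fin d → Set ℝ} (hB : ∀ i, MeasurableSet (B i)) :
    volume {z : EuclideanSpace ℝ (Fin d) | ∀ i, z i ∈ B i} = ∏ i, volume (B i) := by
  rw [← volume_pi_pi, ← (PiLp.volume_preserving_ofLp (Fin d)).measure_preimage
    (MeasurableSet.univ_pi hB).nullMeasurableSet]
  congr 1
  ext z
  simp

/-- Enlarging the window around a point of an interval enlarges the length of the part of the
interval in the window by no more than the ratio of the windows. -/
theorem volume_convex_inter_Icc_le {I : Set ℝ} (hI : Convex ℝ I) {x : ℝ} (hx : x ∈ I) {ε D : ℝ}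
    (hε : 0 < ε) (hD : ε ≤ D) :
    volume (I ∩ Set.Icc (x - D) (x + D)) ≤
      ENNReal.ofReal (D / ε) * volume (I ∩ Set.Icc (x - ε) (x + ε)) := by
  have hD0 : 0 < D := hε.trans_le hD
  have hsub : I ∩ Set.Icc (x - D) (x + D) ⊆
      AffineMap.homothety x (D / ε) '' (I ∩ Set.Icc (x - ε) (x + ε)) := by
    rintro t ⟨htI, ht⟩
    have habs : |t - x| ≤ D := abs_le.mpr ⟨by linarith [ht.1], by linarith [ht.2]⟩
    refine ⟨(1 - ε / D) • x + (ε / D) • t, ⟨?_, ?_⟩, ?_⟩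
    · refine hI hx htI ?_ (by positivity) (by ring)
      rw [sub_nonneg, div_le_one hD0]
      exact hD
    · have : |ε / D * (t - x)| ≤ ε := by
        rw [abs_mul, abs_of_pos (div_pos hε hD0)]
        calc ε / D * |t - x| ≤ ε / D * D := by gcongr
          _ = ε := by field_simp
      rw [abs_le] at this
      simp only [smul_eq_mul]
      constructor <;> linarith
    · simp only [AffineMap.homothety_apply, smul_eq_mul, vsub_eq_sub, vadd_eq_add]
      field_simp
      ring
  refine (measure_mono hsub).trans ?_
  rw [Measure.addHaar_image_homothety]
  simp [abs_of_pos (div_pos hD0 hε)]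

namespace SlicingSchedule

variable {d : ℕ} (S : SlicingSchedule d) (μ : Measure (EuclideanSpace ℝ (Fin d)))

theorem convex_cell (k : ℕ) (w : List Bool) : Convex ℝ (S.cell μ k w) := by
  induction k generalizing w with
  | zero => exact convex_univ
  | succ k ih =>
    have hlin : IsLinearMap ℝ fun x : EuclideanSpace ℝ (Fin d) => inner ℝ x (S.dir k) :=
      ⟨fun x y => inner_add_left _ _ _, fun c x => by simp [inner_smul_left]⟩
    rw [cell]
    split_ifs
    · exact (ih _).inter (convex_halfSpace_le hlin _)
    · exact (ih _).inter (convex_halfSpace_gt hlin _)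
    · exact ih _

variable {S} in
/-- The cells of an axis-parallel schedule are boxes: membership can be tested one coordinate at a
time. -/
theorem AxisParallel.mem_cell_iff_replaceCoord (hS : S.AxisParallel) (k : ℕ) (w : List Bool)
    {x : EuclideanSpace ℝ (Fin d)} (hx : x ∈ S.cell μ k w) (z : EuclideanSpace ℝ (Fin d)) :
    z ∈ S.cell μ k w ↔ ∀ i, replaceCoord x i (z i) ∈ S.cell μ k w := by
  induction k generalizing w with
  | zero => simp [cell]
  | succ k ih =>
    obtain ⟨j, c, hjc⟩ := hS k
    have key (p : ℝ → Prop) (hp : p (x j)) : p (z j) ↔ ∀ i, p (replaceCoord x i (z i) j) := by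
      constructor
      · intro h i
        rw [replaceCoord_apply]
        split_ifs with hij
        · exact hij ▸ h
        · exact hp
      · intro h
        simpa [replaceCoord_apply] using h j
    rw [cell] at hx ⊢
    split_ifs at hx ⊢
    · rw [Set.mem_inter_iff, ih _ hx.1]
      simp only [Set.mem_inter_iff, Set.mem_ofPred_eq, forall_and, hjc, inner_smul_single] at hx ⊢
      rw [← key (fun t => c * t ≤ _) hx.2]
    · rw [Set.mem_inter_iff, ih _ hx.1]
      simp only [Set.mem_inter_iff, Set.mem_ofPred_eq, forall_and, hjc, inner_smul_single] at hx ⊢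
      rw [← key (fun t => _ < c * t) hx.2]
    · exact ih _ hx

theorem cell_address_succ_of_ne {x : EuclideanSpace ℝ (Fin d)} {k : ℕ}
    (h : S.address μ x k ≠ S.label k) :
    S.cell μ (k + 1) (S.address μ x (k + 1)) = S.cell μ k (S.address μ x k) := by
  rw [address, if_neg h, S.cell_succ_of_mem μ (S.address_mem μ x k)]

theorem mem_cell_address_succ_iff {x : EuclideanSpace ℝ (Fin d)} {k : ℕ}
    (h : S.address μ x k = S.label k) (z : EuclideanSpace ℝ (Fin d)) :
    z ∈ S.cell μ (k + 1) (S.address μ x (k + 1)) ↔ z ∈ S.cell μ k (S.address μ x k) ∧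
      (cutLevel μ (S.cell μ k (S.label k)) (S.dir k) < inner ℝ z (S.dir k) ↔
        cutLevel μ (S.cell μ k (S.label k)) (S.dir k) < inner ℝ x (S.dir k)) := by
  rw [address, if_pos h, h]
  by_cases hx : cutLevel μ (S.cell μ k (S.label k)) (S.dir k) < inner ℝ x (S.dir k)
  · simp [hx, cell_succ_true]
  · simp [hx, cell_succ_false]

theorem cell_address_antitone (x : EuclideanSpace ℝ (Fin d)) :
    Antitone fun k => S.cell μ k (S.address μ x k) := by
  refine antitone_nat_of_succ_le fun k z hz => ?_
  by_cases h : S.address μ x k = S.label k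
  · exact ((S.mem_cell_address_succ_iff μ h z).mp hz).1
  · rwa [S.cell_address_succ_of_ne μ h] at hz

variable {μ} in
/-- Each cut of the set containing `x` removes exactly half of its mass. -/
theorem measure_cell_address_diff [IsProbabilityMeasure μ] (hμ : μ ≪ volume)
    {x : EuclideanSpace ℝ (Fin d)} {k : ℕ} (h : S.address μ x k = S.label k) :
    μ (S.cell μ k (S.address μ x k) \ S.cell μ (k + 1) (S.address μ x (k + 1))) =
      μ (S.cell μ (k + 1) (S.address μ x (k + 1))) := by
  have hspec := cutLevel_spec hμ (S.cell μ k (S.label k)) (S.norm_dir k)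
  by_cases hx : cutLevel μ (S.cell μ k (S.label k)) (S.dir k) < inner ℝ x (S.dir k)
  · have e : S.address μ x (k + 1) = S.label k ++ [true] := by simp [address, h, hx]
    rw [e, h, cell_succ_true, hspec.2, ← hspec.1]
    congr 1
    ext z
    simp
  · have e : S.address μ x (k + 1) = S.label k ++ [false] := by simp [address, h, hx]
    rw [e, h, cell_succ_false, hspec.1, ← hspec.2]
    congr 1
    ext z
    simp

end SlicingSchedule

/-- A compact convex set with nonempty interior. -/
structure IsBody {d : ℕ} (K : Set (EuclideanSpace ℝ (Fin d))) : Prop where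
  isCompact : IsCompact K
  convex : Convex ℝ K
  nonempty_interior : (interior K).Nonempty

namespace IsBody

variable {d : ℕ} {K L : Set (EuclideanSpace ℝ (Fin d))}

theorem volume_ne_zero (hK : IsBody K) : volume K ≠ 0 :=
  (Measure.measure_pos_of_nonempty_interior _ hK.nonempty_interior).ne'

theorem isProbabilityMeasure (hK : IsBody K) :
    IsProbabilityMeasure volume[|K] :=
  ProbabilityTheory.cond_isProbabilityMeasure_of_finite hK.volume_ne_zero
    hK.isCompact.measure_lt_top.ne

theorem cond_apply_eq_iff (hK : IsBody K) {A B : Set (EuclideanSpace ℝ (Fin d))} :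
    volume[|K] A = volume[|K] B ↔
      volume (K ∩ A) = volume (K ∩ B) := by
  rw [ProbabilityTheory.cond_apply hK.isCompact.measurableSet,
    ProbabilityTheory.cond_apply hK.isCompact.measurableSet,
    ENNReal.mul_right_inj (ENNReal.inv_ne_zero.mpr hK.isCompact.measure_lt_top.ne)
    (ENNReal.inv_ne_top.mpr hK.volume_ne_zero)]

end IsBody

namespace SlicingSchedule

variable {d : ℕ} (S : SlicingSchedule d)

variable {S} in
/-- Suppose that the cells `C k` containing `x` never shrink to the value `x j` in the `j`-th
coordinate: they all contain a point `y` with `y j ≠ x j`. Each cut in direction `j` removes from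
`C k` a slab with the same mass as the remaining part. The remaining part contains a box around a
neighbourhood of `x` whose extension in direction `j` does not depend on `k`, and the cross-sections
of the slab and of this box are comparable. So the widths of the slabs are bounded below; since they
are disjoint and meet a bounded set, there are only finitely many of them. -/
theorem coord_eq_of_address_eq (hS : S.Admissible) (hS' : S.AxisParallel)
    {K : Set (EuclideanSpace ℝ (Fin d))} (hK : IsBody K) {x y : EuclideanSpace ℝ (Fin d)}
    (hx : x ∈ interior K)
    (h : ∀ k, S.address volume[|K] x k =
      S.address volume[|K] y k) (j : Fin d) : x j = y j := by
  by_contra hne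
  have := hK.isProbabilityMeasure
  have hac : volume[|K] ≪ volume :=
    ProbabilityTheory.cond_absolutelyContinuous
  set μ := volume[|K] with hμ
  set C : ℕ → Set (EuclideanSpace ℝ (Fin d)) := fun k => S.cell μ k (S.address μ x k) with hC
  have hanti : Antitone C := S.cell_address_antitone μ x
  have hxC (k) : x ∈ C k := S.mem_cell_address μ x k
  have hyC (k) : y ∈ C k := by
    simp only [hC, h k]
    exact S.mem_cell_address μ y k
  -- the one-dimensional sections through `x`
  set I : ℕ → Fin d → Set ℝ := fun k i => replaceCoord x i ⁻¹' C k with hI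
  have hbox (k z) : z ∈ C k ↔ ∀ i, z i ∈ I k i :=
    hS'.mem_cell_iff_replaceCoord μ k _ (hxC k) z
  have hIconv (k i) : Convex ℝ (I k i) :=
    convex_preimage_replaceCoord x i (S.convex_cell μ k _)
  have hImeas (k i) : MeasurableSet (I k i) := (hIconv k i).ordConnected.measurableSet
  have hIanti (i) : Antitone fun k => I k i := fun k l hkl => Set.preimage_mono (hanti hkl)
  have hxI (k i) : x i ∈ I k i := by
    simp only [hI, Set.mem_preimage, replaceCoord_self]
    exact hxC k
  obtain ⟨ε, hε, hεK⟩ : ∃ ε : ℝ, 0 < ε ∧ ∀ z : EuclideanSpace ℝ (Fin d),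
      (∀ i, z i ∈ Set.Icc (x i - ε) (x i + ε)) → z ∈ K := by
    have hmem : WithLp.toLp 2 ⁻¹' K ∈ 𝓝 x.ofLp :=
      (PiLp.continuous_toLp 2 fun _ : Fin d => ℝ).continuousAt.preimage_mem_nhds
        (mem_interior_iff_mem_nhds.mp hx)
    obtain ⟨ε, hε, hsub⟩ := Metric.nhds_basis_closedBall.mem_iff.mp hmem
    refine ⟨ε, hε, fun z hz => hsub (a := z.ofLp) ?_⟩
    rw [Metric.mem_closedBall, dist_pi_le_iff hε.le]
    intro i
    rw [Real.dist_eq, abs_le]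
    constructor <;> linarith [(hz i).1, (hz i).2]
  obtain ⟨D, hεD, hDK⟩ : ∃ D : ℝ, ε ≤ D ∧ ∀ z ∈ K, ∀ i,
      z i ∈ Set.Icc (x i - D) (x i + D) := by
    obtain ⟨R, hR⟩ := hK.isCompact.isBounded.subset_closedBall x
    refine ⟨max ε R, le_max_left _ _, fun z hz i => ?_⟩
    have h1 : |z i - x i| ≤ max ε R := by
      refine ((PiLp.norm_apply_le (z - x) i).trans ?_).trans (le_max_right _ _)
      rw [← dist_eq_norm]
      exact hR hz
    rw [abs_le] at h1
    constructor <;> linarith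
  set n := (Finset.univ.erase j).card with hn
  set M : ℝ≥0∞ := ENNReal.ofReal (D / ε) with hM
  set δ : ℝ≥0∞ := volume (Set.uIcc (x j) (y j) ∩ Set.Icc (x j - ε) (x j + ε)) with hδ
  have hδpos : δ ≠ 0 := by
    have hlt : min (x j) (y j) ⊔ (x j - ε) < max (x j) (y j) ⊓ (x j + ε) := by
      rcases lt_or_gt_of_ne hne with h | h
      · rw [min_eq_left h.le, max_eq_right h.le]
        simp only [sup_lt_iff, lt_inf_iff]
        refine ⟨⟨?_, ?_⟩, ?_, ?_⟩ <;> linarith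
      · rw [min_eq_right h.le, max_eq_left h.le]
        simp only [sup_lt_iff, lt_inf_iff]
        refine ⟨⟨?_, ?_⟩, ?_, ?_⟩ <;> linarith
    rw [hδ, Set.uIcc, Set.Icc_inter_Icc, Real.volume_Icc]
    exact (ENNReal.ofReal_pos.mpr (sub_pos.mpr hlt)).ne'
  set Z : ℕ → Set ℝ := fun k => (I k j \ I (k + 1) j) ∩ Set.Icc (x j - D) (x j + D) with hZ
  have hZmeas (k) : MeasurableSet (Z k) :=
    ((hImeas k j).diff (hImeas (k + 1) j)).inter measurableSet_Icc
  have hZdisj : Pairwise (Function.onFun Disjoint Z) := by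
    have hlt : ∀ k l, k < l → Disjoint (Z k) (Z l) := fun k l hkl =>
      Set.disjoint_left.mpr fun t hk hl => hk.1.2 (hIanti j (Nat.succ_le_of_lt hkl) hl.1.1)
    intro k l hkl
    rcases lt_or_gt_of_ne hkl with hkl | hkl
    · exact hlt k l hkl
    · exact (hlt l k hkl).symm
  have hZfin : volume (⋃ k, Z k) ≠ ∞ :=
    ((measure_mono (Set.iUnion_subset fun k => Set.inter_subset_right)).trans_lt
      measure_Icc_lt_top).ne
  have hMn : M ^ n ≠ ∞ := ENNReal.pow_ne_top ENNReal.ofReal_ne_top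
  have hfin := Measure.finite_const_le_meas_of_disjoint_iUnion volume
    (ENNReal.div_pos hδpos hMn) hZmeas hZdisj hZfin
  obtain ⟨c, hc, hinf⟩ := hS.infinite_setOf_cut μ hS' x j
  refine hinf (hfin.subset ?_)
  rintro k ⟨hk, hdir⟩
  -- the half-space condition at step `k` concerns the `j`-th coordinate only
  have hother {i} (hij : i ≠ j) {t : ℝ} (ht : t ∈ I k i) : t ∈ I (k + 1) i := by
    refine (S.mem_cell_address_succ_iff μ hk _).mpr ⟨ht, ?_⟩
    rw [hdir, inner_smul_single, inner_smul_single, replaceCoord_apply, if_neg hij.symm]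
  have hmass : volume (K ∩ (C k \ C (k + 1))) = volume (K ∩ C (k + 1)) :=
    hK.cond_apply_eq_iff.mp (S.measure_cell_address_diff hac hk)
  have hpos : volume (K ∩ C (k + 1)) ≠ 0 := by
    intro h0
    apply S.measure_cell_ne_zero hac (S.address_mem μ x (k + 1))
    change μ (C (k + 1)) = 0
    rw [hμ, ProbabilityTheory.cond_apply hK.isCompact.measurableSet, h0, mul_zero]
  set V : ℝ → ℝ≥0∞ := fun r =>
    ∏ i ∈ Finset.univ.erase j, volume (I k i ∩ Set.Icc (x i - r) (x i + r)) with hV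
  have hVle : V D ≤ M ^ n * V ε := by
    rw [hn, ← Finset.prod_const, ← Finset.prod_mul_distrib]
    exact Finset.prod_le_prod' fun i _ => volume_convex_inter_Icc_le (hIconv k i) (hxI k i) hε hεD
  have hVfin : V ε ≠ ∞ := ENNReal.prod_ne_top fun i _ =>
    ((measure_mono Set.inter_subset_right).trans_lt measure_Icc_lt_top).ne
  have hvol (A : Set ℝ) (B : Fin d → Set ℝ) (hA : MeasurableSet A) (hB : ∀ i, MeasurableSet (B i)) :
      volume {z : EuclideanSpace ℝ (Fin d) | ∀ i, z i ∈ if i = j then A else B i} =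
        volume A * ∏ i ∈ Finset.univ.erase j, volume (B i) := by
    rw [volume_setOf_forall_mem (B := fun i => if i = j then A else B i)
        (fun i => by split_ifs; exacts [hA, hB i]),
      ← Finset.mul_prod_erase Finset.univ _ (Finset.mem_univ j), if_pos rfl]
    congr 1
    exact Finset.prod_congr rfl fun i hi => by rw [if_neg (Finset.ne_of_mem_erase hi)]
  have hupper : volume (K ∩ (C k \ C (k + 1))) ≤ volume (Z k) * V D := by
    have hsub : K ∩ (C k \ C (k + 1)) ⊆ {z | ∀ i, z i ∈
        if i = j then Z k else I k i ∩ Set.Icc (x i - D) (x i + D)} := by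
      rintro z ⟨hzK, hzk, hzk'⟩ i
      have hzI := (hbox k z).mp hzk
      split_ifs with hij
      · subst hij
        refine ⟨⟨hzI i, fun hzi => hzk' ((hbox (k + 1) z).mpr fun i' => ?_)⟩, hDK z hzK i⟩
        by_cases h : i' = i
        · exact h ▸ hzi
        · exact hother h (hzI i')
      · exact ⟨hzI i, hDK z hzK i⟩
    refine (measure_mono hsub).trans ?_
    rw [hvol]
    · exact hZmeas k
    · exact fun i => (hImeas k i).inter measurableSet_Icc
  have hlower : δ * V ε ≤ volume (K ∩ C (k + 1)) := by
    have hsub : {z : EuclideanSpace ℝ (Fin d) | ∀ i, z i ∈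
        if i = j then Set.uIcc (x j) (y j) ∩ Set.Icc (x j - ε) (x j + ε)
        else I k i ∩ Set.Icc (x i - ε) (x i + ε)} ⊆ K ∩ C (k + 1) := by
      intro z hz
      refine ⟨hεK z fun i => ?_, (hbox (k + 1) z).mpr fun i => ?_⟩
      · have := hz i
        split_ifs at this with hij
        · exact hij ▸ this.2
        · exact this.2
      · have := hz i
        split_ifs at this with hij
        · subst hij
          exact (hIconv (k + 1) i).ordConnected.uIcc_subset (hxI (k + 1) i)
            ((hbox (k + 1) y).mp (hyC (k + 1)) i) this.1
        · exact hother hij this.1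
    refine le_trans ?_ (measure_mono hsub)
    rw [hvol]
    · exact measurableSet_uIcc.inter measurableSet_Icc
    · exact fun i => (hImeas k i).inter measurableSet_Icc
  have hV0 : V ε ≠ 0 := by
    intro h0
    rw [h0, mul_zero, nonpos_iff_eq_zero] at hVle
    rw [hVle, mul_zero, nonpos_iff_eq_zero, hmass] at hupper
    exact hpos hupper
  refine ENNReal.div_le_of_le_mul ?_
  refine (ENNReal.mul_le_mul_iff_left hV0 hVfin).mp ?_
  calc δ * V ε ≤ volume (Z k) * V D := hlower.trans (hmass ▸ hupper)
    _ ≤ volume (Z k) * (M ^ n * V ε) := by gcongr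
    _ = volume (Z k) * M ^ n * V ε := by rw [mul_assoc]

end SlicingSchedule

/-! ### Uniform measures on convex bodies -/

namespace IsBody

variable {d : ℕ} {K L : Set (EuclideanSpace ℝ (Fin d))}

theorem interior_support (hK : IsBody K) :
    interior volume[|K].support = interior K := by
  have hm := hK.isCompact.measurableSet
  apply Set.Subset.antisymm
  · refine interior_mono (Measure.support_subset_of_isClosed hK.isCompact.isClosed ?_)
    exact ProbabilityTheory.ae_cond_mem hm
  · refine interior_maximal (fun x hx => ?_) isOpen_interior
    rw [Measure.mem_support_iff_forall]
    intro U hU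
    rw [ProbabilityTheory.cond_apply hm]
    refine ENNReal.mul_pos (ENNReal.inv_ne_zero.mpr hK.isCompact.measure_lt_top.ne) ?_
    have : K ∩ U ∈ 𝓝 x := Filter.inter_mem (mem_interior_iff_mem_nhds.mp hx) hU
    exact (Measure.measure_pos_of_mem_nhds volume this).ne'

theorem ae_mem_interior (hK : IsBody K) :
    ∀ᵐ x ∂volume[|K], x ∈ interior K := by
  have h1 := ProbabilityTheory.ae_cond_mem (μ := volume) hK.isCompact.measurableSet
  have h2 : ∀ᵐ x ∂volume[|K], x ∉ frontier K :=
    ProbabilityTheory.cond_absolutelyContinuous.ae_le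
      (measure_eq_zero_iff_ae_notMem.mp (hK.convex.addHaar_frontier volume))
  filter_upwards [h1, h2] with x hx hx'
  rw [frontier, Set.mem_sdiff, not_and_not_right] at hx'
  exact hx' (subset_closure hx)

theorem eq_of_cond_eq (hK : IsBody K) (hL : IsBody L)
    (h : volume[|K] = volume[|L]) : K = L := by
  have hint : interior K = interior L := by rw [← hK.interior_support, h, hL.interior_support]
  rw [← hK.isCompact.isClosed.closure_eq, ← hL.isCompact.isClosed.closure_eq,
    ← hK.convex.closure_interior_eq_closure_of_nonempty_interior hK.nonempty_interior,
    ← hL.convex.closure_interior_eq_closure_of_nonempty_interior hL.nonempty_interior, hint]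

theorem exists_norm_le (hK : IsBody K) :
    ∃ R, ∀ x ∈ interior K, ‖x‖ ≤ R := by
  obtain ⟨R, hR⟩ := hK.isCompact.isBounded.exists_norm_le
  exact ⟨R, fun x hx => hR x (interior_subset hx)⟩

end IsBody

namespace SlicingSchedule

variable {d : ℕ} {S : SlicingSchedule d} {K L : Set (EuclideanSpace ℝ (Fin d))}

theorem injOn_limitFun (hS : S.Admissible) (hS' : S.AxisParallel) (hK : IsBody K) :
    Set.InjOn (S.limitFun volume[|K]) (interior K) := by
  intro x hx y _ hxy
  ext j
  exact coord_eq_of_address_eq hS hS' hK hx (S.address_eq_of_limitFun_eq _ hxy) j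

/-! ### The no-collision map and transport -/

/-- By the Lusin–Souslin theorem `limitFun` has a measurable left inverse on the interior of the
support. -/
theorem exists_measurable_leftInvOn_limitFun (hS : S.Admissible) (hS' : S.AxisParallel)
    (hK : IsBody K) :
    ∃ g : ℝ → EuclideanSpace ℝ (Fin d), Measurable g ∧
      MeasurableSet (S.limitFun volume[|K] '' interior K) ∧
      ∀ x ∈ interior K, g (S.limitFun volume[|K] x) = x := by
  set f := S.limitFun volume[|K]
  have hf : Measurable f := S.measurable_limitFun _
  have hemb : MeasurableEmbedding ((interior K).domRestrict f) := by
    have : StandardBorelSpace (interior K) := isOpen_interior.measurableSet.standardBorel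
    exact (hf.comp measurable_subtype_coe).measurableEmbedding
      (Set.injOn_iff_injective.mp (injOn_limitFun hS hS' hK))
  obtain ⟨g, hg, hgf⟩ := hemb.exists_measurable_extend measurable_subtype_coe fun _ => ⟨0⟩
  refine ⟨g, hg, ?_, fun x hx => congrFun hgf ⟨x, hx⟩⟩
  rw [← Set.range_domRestrict]
  exact hemb.measurableSet_range

/-- The limit code of almost every point of one body is the limit code of an interior point of any
other one, because the limit codes have the same distribution. -/
theorem ae_exists_limitFun_eq (hS : S.Admissible) (hS' : S.AxisParallel) (hK : IsBody K)
    (hL : IsBody L) :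
    ∀ᵐ x ∂volume[|K], ∃ y ∈ interior L,
      S.limitFun volume[|L] y = S.limitFun volume[|K] x := by
  have := hK.isProbabilityMeasure
  have := hL.isProbabilityMeasure
  obtain ⟨g, -, hmeas, -⟩ := exists_measurable_leftInvOn_limitFun hS hS' hL
  have h1 : ∀ᵐ t ∂volume[|L].map (S.limitFun volume[|L]),
      t ∈ S.limitFun volume[|L] '' interior L := by
    refine (ae_map_iff (S.measurable_limitFun _).aemeasurable hmeas).mpr ?_
    filter_upwards [hL.ae_mem_interior] with x hx
    exact Set.mem_image_of_mem _ hx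
  rw [← S.map_limitFun_eq (μ := volume[|K])
    ProbabilityTheory.cond_absolutelyContinuous ProbabilityTheory.cond_absolutelyContinuous] at h1
  exact (ae_map_iff (S.measurable_limitFun _).aemeasurable hmeas).mp h1

theorem noCollisionMap_eq (hS : S.Admissible) (hS' : S.AxisParallel) (hL : IsBody L)
    {μ : Measure (EuclideanSpace ℝ (Fin d))} {x y : EuclideanSpace ℝ (Fin d)}
    (hy : y ∈ interior L)
    (hxy : S.limitFun volume[|L] y = S.limitFun μ x) :
    S.noCollisionMap μ volume[|L] x = y := by
  have hex : ∃! y, y ∈ interior volume[|L].support ∧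
      S.limitFun volume[|L] y = S.limitFun μ x := by
    rw [hL.interior_support]
    exact ⟨y, ⟨hy, hxy⟩, fun z hz =>
      injOn_limitFun hS hS' hL hz.1 hy (hz.2.trans hxy.symm)⟩
  rw [noCollisionMap, dif_pos hex]
  exact hex.unique hex.choose_spec.1 ⟨hL.interior_support ▸ hy, hxy⟩

theorem ae_noCollisionMap_mem (hS : S.Admissible) (hS' : S.AxisParallel) (hK : IsBody K)
    (hL : IsBody L) :
    ∀ᵐ x ∂volume[|K], S.noCollisionMap volume[|K] volume[|L] x ∈ interior L := by
  filter_upwards [ae_exists_limitFun_eq hS hS' hK hL] with x ⟨y, hy, hxy⟩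
  rw [noCollisionMap_eq hS hS' hL hy hxy]
  exact hy

theorem noCollisionMap_ae_eq_comp (hS : S.Admissible) (hS' : S.AxisParallel) (hK : IsBody K)
    (hL : IsBody L) {g : ℝ → EuclideanSpace ℝ (Fin d)}
    (hg : ∀ x ∈ interior L, g (S.limitFun volume[|L] x) = x) :
    S.noCollisionMap volume[|K] volume[|L] =ᵐ[volume[|K]] g ∘ S.limitFun volume[|K] := by
  filter_upwards [ae_exists_limitFun_eq hS hS' hK hL] with x ⟨y, hy, hxy⟩
  rw [noCollisionMap_eq hS hS' hL hy hxy, Function.comp_apply, ← hxy, hg y hy]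

theorem aemeasurable_noCollisionMap (hS : S.Admissible) (hS' : S.AxisParallel) (hK : IsBody K)
    (hL : IsBody L) :
    AEMeasurable (S.noCollisionMap volume[|K] volume[|L]) volume[|K] := by
  obtain ⟨g, hg, -, hgL⟩ := exists_measurable_leftInvOn_limitFun hS hS' hL
  exact ⟨_, hg.comp (S.measurable_limitFun _), noCollisionMap_ae_eq_comp hS hS' hK hL hgL⟩

theorem map_noCollisionMap (hS : S.Admissible) (hS' : S.AxisParallel) (hK : IsBody K)
    (hL : IsBody L) :
    volume[|K].map (S.noCollisionMap volume[|K] volume[|L]) = volume[|L] := by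
  have := hK.isProbabilityMeasure
  have := hL.isProbabilityMeasure
  obtain ⟨g, hg, -, hgL⟩ := exists_measurable_leftInvOn_limitFun hS hS' hL
  rw [Measure.map_congr (noCollisionMap_ae_eq_comp hS hS' hK hL hgL),
    ← Measure.map_map hg (S.measurable_limitFun _),
    S.map_limitFun_eq (ν := volume[|L])
      ProbabilityTheory.cond_absolutelyContinuous ProbabilityTheory.cond_absolutelyContinuous,
    Measure.map_map hg (S.measurable_limitFun _)]
  have hid : g ∘ S.limitFun volume[|L] =ᵐ[volume[|L]] id := by
    filter_upwards [hL.ae_mem_interior] with x hx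
    exact hgL x hx
  rw [Measure.map_congr hid, Measure.map_id]

end SlicingSchedule

/-! ### Translations -/

theorem cond_map_equiv {α : Type*} [MeasurableSpace α] {μ : Measure α} (e : α ≃ᵐ α)
    (he : MeasurePreserving e μ μ) (A : Set α) (hA : MeasurableSet A) :
    (μ[|A]).map e = μ[|e '' A] := by
  ext B hB
  have hA' : MeasurableSet (e '' A) := e.measurableSet_image.mpr hA
  rw [e.map_apply, ProbabilityTheory.cond_apply hA, ProbabilityTheory.cond_apply hA',
    ← he.measure_preimage_equiv (e '' A), ← he.measure_preimage_equiv (e '' A ∩ B),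
    Set.preimage_inter, e.injective.preimage_image]

theorem cond_map_add {d : ℕ} (v : EuclideanSpace ℝ (Fin d)) {A : Set (EuclideanSpace ℝ (Fin d))}
    (hA : MeasurableSet A) :
    volume[|A].map (· + v) = volume[|(· + v) '' A] :=
  cond_map_equiv (MeasurableEquiv.addRight v) (measurePreserving_add_right volume v) A hA

theorem interior_image_add {d : ℕ} (v : EuclideanSpace ℝ (Fin d))
    (A : Set (EuclideanSpace ℝ (Fin d))) : interior ((· + v) '' A) = (· + v) '' interior A :=
  ((Homeomorph.addRight v).image_interior A).symm

theorem IsBody.image_add {d : ℕ} {K : Set (EuclideanSpace ℝ (Fin d))} (hK : IsBody K)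
    (v : EuclideanSpace ℝ (Fin d)) : IsBody ((· + v) '' K) where
  isCompact := hK.isCompact.image (by fun_prop)
  convex := by simpa only [add_comm] using hK.convex.translate v
  nonempty_interior := by
    rw [interior_image_add]
    exact hK.nonempty_interior.image _

/-- For a set of positive mass the cut level moves with the measure. (For null sets it is `0`.) -/
theorem cutLevel_map_add {d : ℕ} {μ : Measure (EuclideanSpace ℝ (Fin d))} [IsFiniteMeasure μ]
    (hμ : μ ≪ volume) {Ω : Set (EuclideanSpace ℝ (Fin d))} (v : EuclideanSpace ℝ (Fin d))
    (h0 : μ ((· + v) ⁻¹' Ω) ≠ 0) {s : EuclideanSpace ℝ (Fin d)} (hs : ‖s‖ = 1) :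
    cutLevel (μ.map (· + v)) Ω s = cutLevel μ ((· + v) ⁻¹' Ω) s + inner ℝ v s := by
  have hleast := isLeast_cutLevel hμ h0 hs
  have hmap (A : Set (EuclideanSpace ℝ (Fin d))) :
      μ.map (· + v) A = μ ((· + v) ⁻¹' A) := (MeasurableEquiv.addRight v).map_apply A
  have hset (h : ℝ) : (μ.map (· + v) (Ω ∩ {x | inner ℝ x s ≤ h}) = μ.map (· + v) Ω / 2 ∧
      μ.map (· + v) (Ω ∩ {x | h < inner ℝ x s}) = μ.map (· + v) Ω / 2) ↔
      h - inner ℝ v s ∈ {h : ℝ | μ ((· + v) ⁻¹' Ω ∩ {x | inner ℝ x s ≤ h}) =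
        μ ((· + v) ⁻¹' Ω) / 2 ∧ μ ((· + v) ⁻¹' Ω ∩ {x | h < inner ℝ x s}) =
        μ ((· + v) ⁻¹' Ω) / 2} := by
    simp only [hmap, Set.preimage_inter, Set.preimage_ofPred_eq, inner_add_left,
      Set.mem_ofPred_eq, le_sub_iff_add_le, sub_lt_iff_lt_add]
  rw [cutLevel]
  refine IsLeast.csInf_eq ⟨?_, fun h hh => ?_⟩
  · rw [Set.mem_ofPred_eq, hset, add_sub_cancel_right]
    exact hleast.1
  · have := hleast.2 ((hset h).mp hh)
    linarith

namespace SlicingSchedule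

variable {d : ℕ} (S : SlicingSchedule d) {K L : Set (EuclideanSpace ℝ (Fin d))}

theorem preimage_cell_map_add {μ : Measure (EuclideanSpace ℝ (Fin d))} [IsProbabilityMeasure μ]
    (hμ : μ ≪ volume) (v : EuclideanSpace ℝ (Fin d)) (k : ℕ) :
    ∀ w ∈ activeLabels S.label k,
      (· + v) ⁻¹' S.cell (μ.map (· + v)) k w = S.cell μ k w := by
  induction k with
  | zero =>
    intro w _
    simp [cell]
  | succ k ih =>
    intro w hw
    have hL := ih _ (S.label_mem k)
    rcases S.mem_activeLabels_succ.mp hw with ⟨-, hw'⟩ | ⟨i, rfl⟩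
    · rw [S.cell_succ_of_mem _ hw', S.cell_succ_of_mem _ hw', ih w hw']
    · have h0 : μ ((· + v) ⁻¹' S.cell (μ.map (· + v)) k (S.label k)) ≠ 0 := by
        rw [hL]
        exact S.measure_cell_ne_zero hμ (S.label_mem k)
      have hcut := cutLevel_map_add hμ v h0 (S.norm_dir k)
      rw [hL] at hcut
      cases i
      · rw [cell_succ_false, cell_succ_false, hcut, Set.preimage_inter, hL]
        simp [inner_add_left]
      · rw [cell_succ_true, cell_succ_true, hcut, Set.preimage_inter, hL]
        simp [inner_add_left]

theorem limitFun_map_add {μ : Measure (EuclideanSpace ℝ (Fin d))} [IsProbabilityMeasure μ]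
    (hμ : μ ≪ volume) (v x : EuclideanSpace ℝ (Fin d)) :
    S.limitFun (μ.map (· + v)) (x + v) = S.limitFun μ x := by
  have h (k) : S.levelFun (μ.map (· + v)) k (x + v) = S.levelFun μ k x := by
    classical
    refine Finset.sum_congr rfl fun w hw => ?_
    rw [← S.preimage_cell_map_add hμ v k w hw]
    rfl
  simp only [limitFun, h]

variable {S}

theorem ae_noCollisionMap_map_add (hS : S.Admissible) (hS' : S.AxisParallel) (hK : IsBody K)
    (hL : IsBody L) (v w : EuclideanSpace ℝ (Fin d)) :
    ∀ᵐ x ∂volume[|K],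
      S.noCollisionMap (volume[|K].map (· + v))
        (volume[|L].map (· + w)) (x + v) =
      S.noCollisionMap volume[|K] volume[|L] x
        + w := by
  have := hK.isProbabilityMeasure
  have := hL.isProbabilityMeasure
  filter_upwards [ae_exists_limitFun_eq hS hS' hK hL] with x ⟨y, hy, hxy⟩
  rw [noCollisionMap_eq hS hS' hL hy hxy, cond_map_add w hL.isCompact.measurableSet]
  refine noCollisionMap_eq hS hS' (hL.image_add w) ?_ ?_
  · rw [interior_image_add]
    exact Set.mem_image_of_mem _ hy
  · rw [← cond_map_add w hL.isCompact.measurableSet,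
      S.limitFun_map_add ProbabilityTheory.cond_absolutelyContinuous,
      S.limitFun_map_add ProbabilityTheory.cond_absolutelyContinuous, hxy]

variable (S) in
/-- The quadratic cost of the no-collision map between the uniform measures on `K` and `L`. -/
noncomputable def transportCost (K L : Set (EuclideanSpace ℝ (Fin d))) : ℝ :=
  ∫ x, ‖S.noCollisionMap volume[|K] volume[|L] x
    - x‖ ^ 2 ∂volume[|K]

theorem integrable_noCollisionMap (hS : S.Admissible) (hS' : S.AxisParallel) (hK : IsBody K)
    (hL : IsBody L) :
    Integrable (S.noCollisionMap volume[|K] volume[|L]) volume[|K] := by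
  have := hK.isProbabilityMeasure
  obtain ⟨R, hR⟩ := hL.exists_norm_le
  refine Integrable.of_bound
    (aemeasurable_noCollisionMap hS hS' hK hL).aestronglyMeasurable R ?_
  filter_upwards [ae_noCollisionMap_mem hS hS' hK hL] with x hx using hR _ hx

theorem integrable_id_cond (hK : IsBody K) :
    Integrable (fun x => x) volume[|K] := by
  have := hK.isProbabilityMeasure
  obtain ⟨R, hR⟩ := hK.exists_norm_le
  refine Integrable.of_bound measurable_id.aestronglyMeasurable R ?_
  filter_upwards [hK.ae_mem_interior] with x hx using hR _ hx

theorem integrable_sq_noCollisionMap_sub (hS : S.Admissible) (hS' : S.AxisParallel)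
    (hK : IsBody K) (hL : IsBody L) :
    Integrable (fun x => ‖S.noCollisionMap volume[|K]
      volume[|L] x - x‖ ^ 2) volume[|K] := by
  have := hK.isProbabilityMeasure
  obtain ⟨R, hR⟩ := hL.exists_norm_le
  obtain ⟨R', hR'⟩ := hK.exists_norm_le
  refine Integrable.of_bound (((aemeasurable_noCollisionMap hS hS' hK hL).sub
    aemeasurable_id).norm.pow_const 2).aestronglyMeasurable ((R + R') ^ 2) ?_
  filter_upwards [ae_noCollisionMap_mem hS hS' hK hL, hK.ae_mem_interior] with x hx hx'
  rw [norm_pow, norm_norm]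
  gcongr
  exact (norm_sub_le _ _).trans (add_le_add (hR _ hx) (hR' _ hx'))

theorem transportCost_nonneg (K L : Set (EuclideanSpace ℝ (Fin d))) : 0 ≤ S.transportCost K L :=
  integral_nonneg fun _ => by positivity

theorem transportCost_self (hS : S.Admissible) (hS' : S.AxisParallel) (hK : IsBody K) :
    S.transportCost K K = 0 := by
  refine integral_eq_zero_of_ae ?_
  filter_upwards [hK.ae_mem_interior] with x hx
  rw [noCollisionMap_eq hS hS' hK hx rfl]
  simp

theorem transportCost_eq_zero_iff (hS : S.Admissible) (hS' : S.AxisParallel) (hK : IsBody K)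
    (hL : IsBody L) : S.transportCost K L = 0 ↔ K = L := by
  refine ⟨fun h => ?_, fun h => h ▸ transportCost_self hS hS' hK⟩
  rw [transportCost, integral_eq_zero_iff_of_nonneg (fun _ => by positivity)
    (integrable_sq_noCollisionMap_sub hS hS' hK hL)] at h
  refine hK.eq_of_cond_eq hL ?_
  have hid : S.noCollisionMap volume[|K] volume[|L] =ᵐ[volume[|K]] id := by
    filter_upwards [h] with x hx
    simpa [sub_eq_zero] using hx
  rw [← map_noCollisionMap hS hS' hK hL, Measure.map_congr hid, Measure.map_id]

/-- The transport map pushes the first measure forward to the second one, so for centred bodies its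
displacement has mean zero and the squared distance of translates splits. -/
theorem noCollisionDist_map_add (hS : S.Admissible) (hS' : S.AxisParallel)
    (hK : IsBody K) (hL : IsBody L) (hK0 : ∫ x, x ∂volume[|K] = 0)
    (hL0 : ∫ x, x ∂volume[|L] = 0) (v w : EuclideanSpace ℝ (Fin d)) :
    S.noCollisionDist 2 (volume[|K].map (· + v))
      (volume[|L].map (· + w)) =
      ENNReal.ofReal (√(S.transportCost K L + ‖v - w‖ ^ 2)) := by
  have := hK.isProbabilityMeasure
  have := hL.isProbabilityMeasure
  set μ := volume[|K]
  set ν := volume[|L]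
  set T := S.noCollisionMap μ ν
  have hT : Integrable T μ := integrable_noCollisionMap hS hS' hK hL
  have hI : Integrable (fun x => x) μ := integrable_id_cond hK
  have hsq : Integrable (fun x => ‖T x - x‖ ^ 2) μ :=
    integrable_sq_noCollisionMap_sub hS hS' hK hL
  have hmean : ∫ x, T x ∂μ = 0 := by
    rw [← integral_map (aemeasurable_noCollisionMap hS hS' hK hL)
      measurable_id'.aestronglyMeasurable, map_noCollisionMap hS hS' hK hL, hL0]
  have hexp (x) : ‖T x + w - (x + v)‖ ^ 2 =
      ‖T x - x‖ ^ 2 + 2 * inner ℝ (w - v) (T x - x) + ‖v - w‖ ^ 2 := by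
    rw [norm_sub_rev v w, show T x + w - (x + v) = (w - v) + (T x - x) by abel, norm_add_sq_real]
    ring
  have hTI : Integrable (fun x => T x - x) μ := hT.sub hI
  have hinner : Integrable (fun x => 2 * inner ℝ (w - v) (T x - x)) μ :=
    (hTI.const_inner (w - v)).const_mul 2
  have hint : ∫ x, ‖T x + w - (x + v)‖ ^ 2 ∂μ = S.transportCost K L + ‖v - w‖ ^ 2 := by
    have hsum : Integrable (fun x => ‖T x - x‖ ^ 2 + 2 * inner ℝ (w - v) (T x - x)) μ :=
      hsq.add hinner
    simp_rw [hexp]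
    rw [integral_add hsum (integrable_const _), integral_add hsq hinner,
      integral_const_mul, integral_inner hTI, integral_sub hT hI, hmean, hK0]
    simp [transportCost, μ, ν, T]
  have hmap (F : EuclideanSpace ℝ (Fin d) → ℝ≥0∞) :
      ∫⁻ x, F x ∂μ.map (· + v) = ∫⁻ x, F (x + v) ∂μ :=
    (MeasurableEquiv.addRight v).measurableEmbedding.lintegral_map F
  rw [noCollisionDist, hmap]
  have hae : (∫⁻ x, edist (S.noCollisionMap (μ.map (· + v)) (ν.map (· + w)) (x + v)) (x + v)
      ^ (2 : ℝ) ∂μ) = ∫⁻ x, ENNReal.ofReal (‖T x + w - (x + v)‖ ^ 2) ∂μ := by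
    refine lintegral_congr_ae ?_
    filter_upwards [ae_noCollisionMap_map_add hS hS' hK hL v w] with x hx
    rw [hx, edist_dist, dist_eq_norm, ENNReal.ofReal_rpow_of_nonneg (norm_nonneg _) zero_le_two,
      Real.rpow_two]
  have hdisp : Integrable (fun x => ‖T x + w - (x + v)‖ ^ 2) μ := by
    simp_rw [hexp]
    exact (hsq.add hinner).add (integrable_const _)
  rw [hae, ← ofReal_integral_eq_lintegral_ofReal hdisp
    (Eventually.of_forall fun _ => by positivity), hint, Real.sqrt_eq_rpow,
    ← ENNReal.ofReal_rpow_of_nonneg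
    (add_nonneg (transportCost_nonneg K L) (by positivity)) (by norm_num)]

end SlicingSchedule

/-! ### Ellipses and rotations -/

/-- The rotation of the plane as a linear isometry. -/
noncomputable def rotationEquiv (t : ℝ) :
    EuclideanSpace ℝ (Fin 2) ≃ₗᵢ[ℝ] EuclideanSpace ℝ (Fin 2) where
  toFun := planeRotation t
  invFun := planeRotation (-t)
  map_add' x y := by
    ext i
    fin_cases i <;> simp [planeRotation] <;> ring
  map_smul' c x := by
    ext i
    fin_cases i <;> simp [planeRotation] <;> ring
  left_inv x := by
    have h := Real.cos_sq_add_sin_sq t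
    ext i
    fin_cases i <;> simp [planeRotation]
    · linear_combination x 0 * h
    · linear_combination x 1 * h
  right_inv x := by
    have h := Real.cos_sq_add_sin_sq t
    ext i
    fin_cases i <;> simp [planeRotation]
    · linear_combination x 0 * h
    · linear_combination x 1 * h
  norm_map' x := by
    have h := Real.cos_sq_add_sin_sq t
    rw [EuclideanSpace.norm_eq, EuclideanSpace.norm_eq]
    congr 1
    simp [planeRotation, Fin.sum_univ_two]
    linear_combination (x 0 ^ 2 + x 1 ^ 2) * h

theorem planeRotation_zero : planeRotation 0 = id := by
  funext x
  ext i
  fin_cases i <;> simp [planeRotation]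

theorem planeRotation_planeRotation (s t : ℝ) (x : EuclideanSpace ℝ (Fin 2)) :
    planeRotation s (planeRotation t x) = planeRotation (t + s) x := by
  ext i
  fin_cases i <;> simp [planeRotation, Real.cos_add, Real.sin_add] <;> ring

theorem planeRotation_add_pi (t : ℝ) (x : EuclideanSpace ℝ (Fin 2)) :
    planeRotation (t + Real.pi) x = -planeRotation t x := by
  ext i
  fin_cases i <;> simp [planeRotation, Real.cos_add, Real.sin_add] <;> ring

theorem norm_planeRotation (t : ℝ) (x : EuclideanSpace ℝ (Fin 2)) : ‖planeRotation t x‖ = ‖x‖ :=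
  (rotationEquiv t).norm_map x

theorem planeRotation_injective (t : ℝ) : Function.Injective (planeRotation t) :=
  (rotationEquiv t).injective

theorem IsBody.image_planeRotation {K : Set (EuclideanSpace ℝ (Fin 2))} (hK : IsBody K) (t : ℝ) :
    IsBody (planeRotation t '' K) where
  isCompact := hK.isCompact.image (rotationEquiv t).continuous
  convex := hK.convex.linear_image (rotationEquiv t).toLinearEquiv.toLinearMap
  nonempty_interior := by
    have := (rotationEquiv t).toHomeomorph.image_interior K
    change planeRotation t '' interior K = interior (planeRotation t '' K) at this
    rw [← this]
    exact hK.nonempty_interior.image _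

theorem cond_map_planeRotation (t : ℝ) {A : Set (EuclideanSpace ℝ (Fin 2))}
    (hA : MeasurableSet A) :
    volume[|A].map (planeRotation t) =
      volume[|planeRotation t '' A] :=
  cond_map_equiv (rotationEquiv t).toMeasurableEquiv (rotationEquiv t).measurePreserving A hA

/-- The barycentre of a centrally symmetric body is its centre. -/
theorem integral_cond_eq_zero {d : ℕ} {K : Set (EuclideanSpace ℝ (Fin d))} (hK : MeasurableSet K)
    (hneg : -K = K) : ∫ x, x ∂volume[|K] = 0 := by
  have hmap : volume[|K].map (fun x => -x) =
      volume[|K] := by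
    have := cond_map_equiv (MeasurableEquiv.neg (EuclideanSpace ℝ (Fin d)))
      (Measure.measurePreserving_neg volume) K hK
    rw [show MeasurableEquiv.neg (EuclideanSpace ℝ (Fin d)) '' K = -K from Set.image_neg_eq_neg,
      hneg] at this
    exact this
  have h : ∫ x, x ∂volume[|K] =
      -∫ x, x ∂volume[|K] := by
    conv_lhs => rw [← hmap]
    rw [integral_map measurable_neg.aemeasurable measurable_id'.aestronglyMeasurable, integral_neg]
  rw [eq_neg_iff_add_eq_zero, ← two_smul ℝ, smul_eq_zero] at h
  exact h.resolve_left two_ne_zero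

theorem mem_ellipse_zero {a b : ℝ} {x : EuclideanSpace ℝ (Fin 2)} :
    x ∈ ellipse a b 0 ↔ x 0 ^ 2 / a ^ 2 + x 1 ^ 2 / b ^ 2 ≤ 1 := by
  simp [ellipse]

theorem ellipse_eq_image_add (a b : ℝ) (u : EuclideanSpace ℝ (Fin 2)) :
    ellipse a b u = (· + u) '' ellipse a b 0 := by
  ext x
  simp [ellipse, sub_eq_add_neg]

theorem isBody_ellipse {a b : ℝ} (ha : 0 < a) (hb : 0 < b) : IsBody (ellipse a b 0) where
  isCompact := by
    refine Metric.isCompact_of_isClosed_isBounded ?_ ?_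
    · simp_rw [ellipse]
      exact isClosed_le (by fun_prop) continuous_const
    · refine isBounded_iff_forall_norm_le.mpr ⟨√(a ^ 2 + b ^ 2), fun x hx => ?_⟩
      rw [mem_ellipse_zero] at hx
      rw [EuclideanSpace.norm_eq, Fin.sum_univ_two]
      refine Real.sqrt_le_sqrt ?_
      simp only [Real.norm_eq_abs, sq_abs]
      have h0 : x 0 ^ 2 / a ^ 2 ≤ 1 := by linarith [show 0 ≤ x 1 ^ 2 / b ^ 2 by positivity]
      have h1 : x 1 ^ 2 / b ^ 2 ≤ 1 := by linarith [show 0 ≤ x 0 ^ 2 / a ^ 2 by positivity]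
      rw [div_le_one (by positivity)] at h0 h1
      exact add_le_add h0 h1
  convex := by
    intro x hx y hy s t hs ht hst
    rw [mem_ellipse_zero] at hx hy ⊢
    have key (p q c : ℝ) : (s * p + t * q) ^ 2 / c ^ 2 ≤
        s * (p ^ 2 / c ^ 2) + t * (q ^ 2 / c ^ 2) := by
      have : s * (p ^ 2 / c ^ 2) + t * (q ^ 2 / c ^ 2) - (s * p + t * q) ^ 2 / c ^ 2 =
          s * t * ((p - q) ^ 2 / c ^ 2) := by
        obtain rfl : t = 1 - s := by linarith
        ring
      have : 0 ≤ s * t * ((p - q) ^ 2 / c ^ 2) := by positivity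
      linarith
    simp only [PiLp.add_apply, PiLp.smul_apply, smul_eq_mul]
    calc _ ≤ s * (x 0 ^ 2 / a ^ 2) + t * (y 0 ^ 2 / a ^ 2) +
          (s * (x 1 ^ 2 / b ^ 2) + t * (y 1 ^ 2 / b ^ 2)) := add_le_add (key _ _ _) (key _ _ _)
      _ = s * (x 0 ^ 2 / a ^ 2 + x 1 ^ 2 / b ^ 2) + t * (y 0 ^ 2 / a ^ 2 + y 1 ^ 2 / b ^ 2) := by
          ring
      _ ≤ s * 1 + t * 1 := by gcongr
      _ = 1 := by linarith
  nonempty_interior := by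
    refine ⟨0, mem_interior.mpr ⟨{x | x 0 ^ 2 / a ^ 2 + x 1 ^ 2 / b ^ 2 < 1}, ?_, ?_, ?_⟩⟩
    · exact fun x hx => mem_ellipse_zero.mpr (le_of_lt hx)
    · exact isOpen_lt (by fun_prop) continuous_const
    · simp

theorem neg_ellipse (a b : ℝ) : -ellipse a b 0 = ellipse a b 0 := by
  ext x
  simp [mem_ellipse_zero]

theorem neg_image_planeRotation_ellipse (a b t : ℝ) :
    -(planeRotation t '' ellipse a b 0) = planeRotation t '' ellipse a b 0 := by
  conv_rhs => rw [← neg_ellipse, ← Set.image_neg_eq_neg, Set.image_image]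
  rw [← Set.image_neg_eq_neg, Set.image_image]
  refine Set.image_congr fun x _ => ?_
  exact ((rotationEquiv t).map_neg x).symm

theorem image_planeRotation_add_pi (a b t : ℝ) :
    planeRotation (t + Real.pi) '' ellipse a b 0 = planeRotation t '' ellipse a b 0 := by
  conv_rhs => rw [← neg_image_planeRotation_ellipse, ← Set.image_neg_eq_neg, Set.image_image]
  exact Set.image_congr fun x _ => planeRotation_add_pi t x

theorem image_planeRotation_disc (a t : ℝ) :
    planeRotation t '' ellipse a a 0 = ellipse a a 0 := by
  have hnorm (x : EuclideanSpace ℝ (Fin 2)) : x ∈ ellipse a a 0 ↔ ‖x‖ ^ 2 / a ^ 2 ≤ 1 := by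
    rw [mem_ellipse_zero, EuclideanSpace.real_norm_sq_eq, Fin.sum_univ_two, add_div]
  ext x
  constructor
  · rintro ⟨y, hy, rfl⟩
    rw [hnorm] at hy ⊢
    rwa [norm_planeRotation]
  · intro hx
    refine ⟨planeRotation (-t) x, ?_, (rotationEquiv t).right_inv x⟩
    rw [hnorm] at hx ⊢
    rwa [norm_planeRotation]

theorem eq_of_image_planeRotation_ellipse_eq {a b : ℝ} (ha : 0 < a) (hb : 0 < b)
    (h : planeRotation (Real.pi / 2) '' ellipse a b 0 = ellipse a b 0) : a = b := by
  have h1 : planeRotation (Real.pi / 2) !₂[a, 0] ∈ ellipse a b 0 := by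
    rw [← h]
    refine Set.mem_image_of_mem _ (mem_ellipse_zero.mpr ?_)
    simp [ha.ne']
  have h2 : planeRotation (Real.pi / 2) !₂[0, b] ∈ ellipse a b 0 := by
    rw [← h]
    refine Set.mem_image_of_mem _ (mem_ellipse_zero.mpr ?_)
    simp [hb.ne']
  rw [mem_ellipse_zero] at h1 h2
  simp only [planeRotation] at h1 h2
  simp at h1 h2
  rw [div_le_one (by positivity)] at h1 h2
  exact le_antisymm (abs_le_of_sq_le_sq' h1 hb.le).2 (abs_le_of_sq_le_sq' h2 ha.le).2

/-- Three rotations of an ellipse that are pairwise different. A rotation by `π / 4` that fixes the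
ellipse would make the rotation by `π / 2` fix it, too. -/
theorem image_planeRotation_ne {a b : ℝ} (ha : 0 < a) (hb : 0 < b) (hab : a ≠ b) :
    planeRotation 0 '' ellipse a b 0 ≠ planeRotation (Real.pi / 4) '' ellipse a b 0 ∧
    planeRotation 0 '' ellipse a b 0 ≠ planeRotation (Real.pi / 2) '' ellipse a b 0 ∧
    planeRotation (Real.pi / 4) '' ellipse a b 0 ≠
      planeRotation (Real.pi / 2) '' ellipse a b 0 := by
  have h2 : planeRotation (Real.pi / 2) '' ellipse a b 0 ≠ ellipse a b 0 := fun h =>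
    hab (eq_of_image_planeRotation_ellipse_eq ha hb h)
  have hdouble : planeRotation (Real.pi / 2) '' ellipse a b 0 =
      planeRotation (Real.pi / 4) '' (planeRotation (Real.pi / 4) '' ellipse a b 0) := by
    rw [Set.image_image]
    refine Set.image_congr fun x _ => ?_
    rw [planeRotation_planeRotation]
    congr 1
    ring
  have h4 : planeRotation (Real.pi / 4) '' ellipse a b 0 ≠ ellipse a b 0 := by
    intro h
    rw [hdouble, h, h] at h2
    exact h2 rfl
  rw [planeRotation_zero, Set.image_id]
  refine ⟨h4.symm, h2.symm, ?_⟩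
  rw [hdouble]
  exact fun h => h4 ((planeRotation_injective _).image_injective h).symm

/-- The rotated measures are translates of uniform measures on centred ellipses. -/
theorem uniformMeasure_map_planeRotation {a b : ℝ} (ha : 0 < a) (hb : 0 < b)
    (u : EuclideanSpace ℝ (Fin 2)) (t : ℝ) :
    (uniformMeasure (ellipse a b u)).map (planeRotation t) =
      (volume[|planeRotation t '' ellipse a b 0]).map
        (· + planeRotation t u) := by
  have hE := isBody_ellipse ha hb
  have hcont : Continuous (planeRotation t) := (rotationEquiv t).continuous
  have hm := hE.isCompact.measurableSet
  rw [uniformMeasure, ellipse_eq_image_add, ← cond_map_add u hm, ← cond_map_planeRotation t hm,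
    Measure.map_map hcont.measurable (measurable_add_const u),
    Measure.map_map (measurable_add_const _) hcont.measurable]
  congr 1
  funext x
  exact (rotationEquiv t).map_add x u

/-- Rotations act transitively on circles. -/
theorem exists_planeRotation_eq {u v : EuclideanSpace ℝ (Fin 2)} (hu : u ≠ 0) (h : ‖v‖ = ‖u‖) :
    ∃ t ∈ Set.Icc 0 (2 * Real.pi), planeRotation t u = v := by
  have hN : 0 < u 0 ^ 2 + u 1 ^ 2 := by
    rw [← Fin.sum_univ_two (fun i => u i ^ 2), ← EuclideanSpace.real_norm_sq_eq]
    positivity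
  have hvu : v 0 ^ 2 + v 1 ^ 2 = u 0 ^ 2 + u 1 ^ 2 := by
    rw [← Fin.sum_univ_two (fun i => u i ^ 2), ← Fin.sum_univ_two (fun i => v i ^ 2),
      ← EuclideanSpace.real_norm_sq_eq, ← EuclideanSpace.real_norm_sq_eq, h]
  set N := u 0 ^ 2 + u 1 ^ 2 with hNdef
  -- the complex quotient `v / u`, whose argument is the angle from `u` to `v`
  set z : ℂ := ⟨(u 0 * v 0 + u 1 * v 1) / N, (u 0 * v 1 - u 1 * v 0) / N⟩ with hz
  have hz1 : ‖z‖ = 1 := by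
    rw [← sq_eq_sq₀ (norm_nonneg _) zero_le_one, Complex.sq_norm, Complex.normSq_apply]
    simp only [hz]
    field_simp
    linear_combination N * hvu - (v 0 ^ 2 + v 1 ^ 2) * hNdef
  have hz0 : z ≠ 0 := norm_ne_zero_iff.mp (by rw [hz1]; norm_num)
  obtain ⟨t, ht, hcos, hsin⟩ : ∃ t ∈ Set.Icc 0 (2 * Real.pi),
      Real.cos t = z.re ∧ Real.sin t = z.im := by
    have hc : Real.cos z.arg = z.re := by rw [Complex.cos_arg hz0, hz1, div_one]
    have hs : Real.sin z.arg = z.im := by rw [Complex.sin_arg, hz1, div_one]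
    have h1 := Complex.neg_pi_lt_arg z
    have h2 := Complex.arg_le_pi z
    have h3 := Real.pi_pos
    rcases le_or_gt 0 z.arg with h0 | h0
    · exact ⟨z.arg, ⟨h0, by linarith⟩, hc, hs⟩
    · exact ⟨z.arg + 2 * Real.pi, ⟨by linarith, by linarith⟩,
        by rw [Real.cos_add_two_pi, hc], by rw [Real.sin_add_two_pi, hs]⟩
  refine ⟨t, ht, ?_⟩
  have hN' := hN.ne'
  ext i
  fin_cases i
  · simp [planeRotation, hcos, hsin, hz]
    field_simp
    rw [hNdef]
    ring
  · simp [planeRotation, hcos, hsin, hz]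
    field_simp
    rw [hNdef]
    ring

/-! ### The isometry with a circle -/

/-- Two chords `p p'` and `q q'` of the same length `ℓ` of a circle, such that opposite sides of the
quadrilateral `p q p' q'` have the same length. The difference of the midpoints is perpendicular to
the chords, as are the midpoints themselves; so these lie on one line through the centre, at the
same distance from it. If they are different, they are antipodal. The excess `c` of the sides
measures their distance. The sums `p + p'` and `q + q'` stand for the midpoints. -/
theorem chord_midpoints {p p' q q' : EuclideanSpace ℝ (Fin 2)} {r ℓ c : ℝ} (hp : ‖p‖ = r)
    (hp' : ‖p'‖ = r) (hq : ‖q‖ = r) (hq' : ‖q'‖ = r) (hℓ : 0 < ℓ) (h1 : ‖p - p'‖ ^ 2 = ℓ)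
    (h2 : ‖q - q'‖ ^ 2 = ℓ) (h3 : ‖p - q‖ ^ 2 = ‖p' - q'‖ ^ 2)
    (h4 : ‖p - q'‖ ^ 2 = ‖p' - q‖ ^ 2) (h5 : ‖p - q‖ ^ 2 + ‖p - q'‖ ^ 2 = 2 * c + ℓ)
    (hc : c ≠ 0) : p + p' ≠ q + q' ∧ p + p' = -(q + q') := by
  have hp := congrArg (· ^ 2) hp
  have hp' := congrArg (· ^ 2) hp'
  have hq := congrArg (· ^ 2) hq
  have hq' := congrArg (· ^ 2) hq'
  simp only [EuclideanSpace.real_norm_sq_eq, Fin.sum_univ_two, PiLp.sub_apply] at *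
  have hmx : (p 0 + p' 0) * (p 0 - p' 0) + (p 1 + p' 1) * (p 1 - p' 1) = 0 := by
    linear_combination hp - hp'
  have hnx : (q 0 + q' 0) * (p 0 - p' 0) + (q 1 + q' 1) * (p 1 - p' 1) = 0 := by
    linear_combination hp - hp' - (h3 + h4) / 2
  have hmm : (p 0 + p' 0) ^ 2 + (p 1 + p' 1) ^ 2 = (q 0 + q' 0) ^ 2 + (q 1 + q' 1) ^ 2 := by
    linear_combination 2 * hp + 2 * hp' - h1 - 2 * hq - 2 * hq' + h2
  have hmn : (p 0 + p' 0 - (q 0 + q' 0)) ^ 2 + (p 1 + p' 1 - (q 1 + q' 1)) ^ 2 = 4 * c := by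
    linear_combination 2 * h5 - h3 - h4 - h1 - h2
  refine ⟨fun h => hc ?_, ?_⟩
  · have e0 : p 0 + p' 0 = q 0 + q' 0 := congrArg (fun z => z 0) h
    have e1 : p 1 + p' 1 = q 1 + q' 1 := congrArg (fun z => z 1) h
    rw [e0, e1] at hmn
    linarith
  generalize p 0 - p' 0 = x₀ at *
  generalize p 1 - p' 1 = x₁ at *
  suffices h : p 0 + p' 0 + (q 0 + q' 0) = 0 ∧ p 1 + p' 1 + (q 1 + q' 1) = 0 by
    ext i
    fin_cases i
    · exact eq_neg_of_add_eq_zero_left h.1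
    · exact eq_neg_of_add_eq_zero_left h.2
  generalize p 0 + p' 0 = m₀ at *
  generalize p 1 + p' 1 = m₁ at *
  generalize q 0 + q' 0 = n₀ at *
  generalize q 1 + q' 1 = n₁ at *
  -- the components of the midpoints along the normal of the chords agree up to sign
  have hcross : (m₁ * x₀ - m₀ * x₁ - (n₁ * x₀ - n₀ * x₁)) *
      (m₁ * x₀ - m₀ * x₁ + (n₁ * x₀ - n₀ * x₁)) = 0 := by
    linear_combination (x₀ ^ 2 + x₁ ^ 2) * hmm - (m₀ * x₀ + m₁ * x₁) * hmx
      + (n₀ * x₀ + n₁ * x₁) * hnx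
  rcases mul_eq_zero.mp hcross with h | h
  · have : ℓ * (4 * c) = 0 := by
      rw [← h1, ← hmn]
      linear_combination (m₁ * x₀ - m₀ * x₁ - (n₁ * x₀ - n₀ * x₁)) * h +
        ((m₀ - n₀) * x₀ + (m₁ - n₁) * x₁) * (hmx - hnx)
    simp [hℓ.ne', hc] at this
  · have : ℓ * ((m₀ + n₀) ^ 2 + (m₁ + n₁) ^ 2) = 0 := by
      rw [← h1]
      linear_combination (m₁ * x₀ - m₀ * x₁ + (n₁ * x₀ - n₀ * x₁)) * h +
        ((m₀ + n₀) * x₀ + (m₁ + n₁) * x₁) * (hmx + hnx)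
    have := (mul_eq_zero.mp this).resolve_left hℓ.ne'
    rw [add_eq_zero_iff_of_nonneg (sq_nonneg _) (sq_nonneg _)] at this
    exact ⟨pow_eq_zero_iff two_ne_zero |>.mp this.1, pow_eq_zero_iff two_ne_zero |>.mp this.2⟩

theorem sq_norm_sub_of_edist_eq {E : Type*} [SeminormedAddCommGroup E] {x y : E} {s : ℝ}
    (hs : 0 ≤ s) (h : edist x y = ENNReal.ofReal (√s)) : ‖x - y‖ ^ 2 = s := by
  rw [edist_dist, dist_eq_norm, ENNReal.ofReal_eq_ofReal_iff (norm_nonneg _) (Real.sqrt_nonneg _)]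
    at h
  rw [h, Real.sq_sqrt hs]

theorem isometricToCircle_disc {a : ℝ} (ha : 0 < a) {u : EuclideanSpace ℝ (Fin 2)} (hu : u ≠ 0)
    {S : SlicingSchedule 2} (hS : S.Admissible) (hS' : S.AxisParallel) :
    IsometricToCircle (rotationFamily (uniformMeasure (ellipse a a u)))
      (S.noCollisionDist 2) := by
  have hE := isBody_ellipse ha ha
  have hmean := integral_cond_eq_zero hE.isCompact.measurableSet (neg_ellipse a a)
  have hrot (t : ℝ) : (uniformMeasure (ellipse a a u)).map (planeRotation t) =
      (volume[|ellipse a a 0]).map (· + planeRotation t u) := by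
    rw [uniformMeasure_map_planeRotation ha ha, image_planeRotation_disc]
  have hdist (v w : EuclideanSpace ℝ (Fin 2)) : edist v w =
      S.noCollisionDist 2 ((volume[|ellipse a a 0]).map (· + v))
        ((volume[|ellipse a a 0]).map (· + w)) := by
    rw [SlicingSchedule.noCollisionDist_map_add hS hS' hE hE hmean hmean,
      SlicingSchedule.transportCost_self hS hS' hE, zero_add, Real.sqrt_sq (norm_nonneg _),
      edist_dist, dist_eq_norm]
  let g : Metric.sphere (0 : EuclideanSpace ℝ (Fin 2)) ‖u‖ →
      rotationFamily (uniformMeasure (ellipse a a u)) := fun v =>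
    ⟨(volume[|ellipse a a 0]).map (· + v.1), by
      obtain ⟨t, ht, htv⟩ := exists_planeRotation_eq hu (mem_sphere_zero_iff_norm.mp v.2)
      exact ⟨t, ht, by simp only [hrot, htv]⟩⟩
  have hg : Function.Bijective g := by
    constructor
    · intro v w h
      have h' := congrArg Subtype.val h
      simp only [g] at h'
      have := hdist v w
      rw [h', ← hdist, edist_self, edist_eq_zero] at this
      exact Subtype.ext this
    · rintro ⟨_, t, ht, rfl⟩
      refine ⟨⟨planeRotation t u, ?_⟩, ?_⟩
      · rw [mem_sphere_zero_iff_norm, norm_planeRotation]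
      · exact Subtype.ext (hrot t).symm
  refine ⟨‖u‖, norm_pos_iff.mpr hu, (Equiv.ofBijective g hg).symm, fun μ ν => ?_⟩
  obtain ⟨v, rfl⟩ := hg.2 μ
  obtain ⟨w, rfl⟩ := hg.2 ν
  rw [Equiv.ofBijective_symm_apply_apply, Equiv.ofBijective_symm_apply_apply]
  exact hdist v w

theorem not_isometricToCircle_ellipse {a b : ℝ} (ha : 0 < a) (hb : 0 < b) (hab : a ≠ b)
    {u : EuclideanSpace ℝ (Fin 2)} (hu : u ≠ 0) {S : SlicingSchedule 2} (hS : S.Admissible)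
    (hS' : S.AxisParallel) :
    ¬IsometricToCircle (rotationFamily (uniformMeasure (ellipse a b u)))
      (S.noCollisionDist 2) := by
  rintro ⟨r, -, f, hf⟩
  set E : ℝ → Set (EuclideanSpace ℝ (Fin 2)) := fun t => planeRotation t '' ellipse a b 0 with hE
  have hbody (t) : IsBody (E t) := (isBody_ellipse ha hb).image_planeRotation t
  have hmean (t) : ∫ x, x ∂volume[|E t] = 0 :=
    integral_cond_eq_zero (hbody t).isCompact.measurableSet
      (neg_image_planeRotation_ellipse a b t)
  -- the images of the measures on the circle
  set P : Set.Icc 0 (2 * Real.pi) → EuclideanSpace ℝ (Fin 2) := fun t =>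
    f ⟨(uniformMeasure (ellipse a b u)).map (planeRotation t), ⟨t, t.2, rfl⟩⟩ with hP
  have hnorm (t) : ‖P t‖ = r := mem_sphere_zero_iff_norm.mp (f _).2
  have hdist (s t) : ‖P s - P t‖ ^ 2 = S.transportCost (E s) (E t) +
      ‖planeRotation s u - planeRotation t u‖ ^ 2 := by
    have h : edist (P s) (P t) = S.noCollisionDist 2
        ((uniformMeasure (ellipse a b u)).map (planeRotation s))
        ((uniformMeasure (ellipse a b u)).map (planeRotation t)) := hf _ _
    refine sq_norm_sub_of_edist_eq
      (add_nonneg (SlicingSchedule.transportCost_nonneg _ _) (by positivity)) (h.trans ?_)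
    rw [uniformMeasure_map_planeRotation ha hb, uniformMeasure_map_planeRotation ha hb]
    exact SlicingSchedule.noCollisionDist_map_add hS hS' (hbody _) (hbody _) (hmean _) (hmean _) _ _
  have hpi := Real.pi_pos
  have hself (t) : S.transportCost (E t) (E t) = 0 :=
    SlicingSchedule.transportCost_self hS hS' (hbody t)
  -- the midpoints (up to the factor `2`) of the chords between the images of opposite measures
  have key (s t s' t' : Set.Icc 0 (2 * Real.pi)) (hs : (s' : ℝ) = s + Real.pi)
      (ht : (t' : ℝ) = t + Real.pi) (hst : E s ≠ E t) :
      P s + P s' ≠ P t + P t' ∧ P s + P s' = -(P t + P t') := by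
    have hEs : E s' = E s := by
      rw [hs]
      exact image_planeRotation_add_pi a b s
    have hEt : E t' = E t := by
      rw [ht]
      exact image_planeRotation_add_pi a b t
    have hus : planeRotation s' u = -planeRotation s u := by rw [hs, planeRotation_add_pi]
    have hut : planeRotation t' u = -planeRotation t u := by rw [ht, planeRotation_add_pi]
    have hopp (v : EuclideanSpace ℝ (Fin 2)) : ‖v - -v‖ ^ 2 = (2 * ‖v‖) ^ 2 := by
      rw [sub_neg_eq_add, ← two_smul ℝ, norm_smul, Real.norm_two]
    refine chord_midpoints (r := r) (ℓ := (2 * ‖u‖) ^ 2) (c := S.transportCost (E s) (E t))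
      (hnorm _) (hnorm _) (hnorm _) (hnorm _) ?_ ?_ ?_ ?_ ?_ ?_ ?_
    · have := norm_pos_iff.mpr hu
      positivity
    · rw [hdist, hEs, hself, hus, hopp, norm_planeRotation, zero_add]
    · rw [hdist, hEt, hself, hut, hopp, norm_planeRotation, zero_add]
    · rw [hdist, hdist, hEs, hEt, hus, hut, neg_sub_neg, norm_sub_rev]
    · rw [hdist, hdist, hEs, hEt, hus, hut, sub_neg_eq_add, ← neg_add', norm_neg]
    · rw [hdist, hdist, hEt, hut, sub_neg_eq_add]
      have := parallelogram_law_with_norm ℝ (planeRotation s u) (planeRotation t u)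
      rw [norm_planeRotation, norm_planeRotation] at this
      linear_combination this
    · rwa [Ne, SlicingSchedule.transportCost_eq_zero_iff hS hS' (hbody s) (hbody t)]
  obtain ⟨h12, h13, h23⟩ := image_planeRotation_ne ha hb hab
  let A (t : ℝ) (h0 : 0 ≤ t) (h1 : t ≤ Real.pi) : Set.Icc 0 (2 * Real.pi) :=
    ⟨t, h0, by linarith⟩
  let A' (t : ℝ) (h0 : 0 ≤ t) (h1 : t ≤ Real.pi) : Set.Icc 0 (2 * Real.pi) :=
    ⟨t + Real.pi, by linarith, by linarith⟩
  have b1 : (0 : ℝ) ≤ 0 ∧ 0 ≤ Real.pi := ⟨le_rfl, hpi.le⟩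
  have b2 : 0 ≤ Real.pi / 4 ∧ Real.pi / 4 ≤ Real.pi := ⟨by linarith, by linarith⟩
  have b3 : 0 ≤ Real.pi / 2 ∧ Real.pi / 2 ≤ Real.pi := ⟨by linarith, by linarith⟩
  have k12 := key (A _ b1.1 b1.2) (A _ b2.1 b2.2) (A' _ b1.1 b1.2) (A' _ b2.1 b2.2) rfl rfl h12
  have k13 := key (A _ b1.1 b1.2) (A _ b3.1 b3.2) (A' _ b1.1 b1.2) (A' _ b3.1 b3.2) rfl rfl h13
  have k23 := key (A _ b2.1 b2.2) (A _ b3.1 b3.2) (A' _ b2.1 b2.2) (A' _ b3.1 b3.2) rfl rfl h23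
  -- three pairwise antipodal midpoints cannot be pairwise different
  exact k23.1 (neg_injective (k12.2.symm.trans k13.2))

theorem mainTheorem3 (a b : ℝ) (ha : 0 < a) (hb : 0 < b)
    (u : EuclideanSpace ℝ (Fin 2)) (hu : u ≠ 0)
    (S : SlicingSchedule 2) (hS : S.Admissible) (hS' : S.AxisParallel) :
    IsometricToCircle (rotationFamily (uniformMeasure (ellipse a b u))) (S.noCollisionDist 2) ↔
      a = b := by
  constructor
  · intro h
    by_contra hab
    exact not_isometricToCircle_ellipse ha hb hab hu hS hS' h
  · rintro rfl
    exact isometricToCircle_disc ha hu hS hS'
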